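/- Let $(\Omega,\mathcal F,(\mathcal F_t)_{t\ge 0},P)$ be a filtered probability space and let $X=(X_t)_{t\ge 0}$ be a spectrally negative Lévy process on it: $X$ is adapted with càdlàg paths, $X_0=0$ a.s., for $s\le t$ the increment $X_t-X_s$ is independent of $\mathcal F_s$ and distributed as $X_{t-s}$, the Lévy measure of $X$ (in the Lévy–Khintchine formula for $E(e^{i\theta X_t})$) does not charge $(0,\infty)$, and the paths of $X$ are not a.s. monotone. Let $\psi(\theta)=\log E(e^{\theta X_1})$ be its Laplace exponent and $\Phi(q)=\sup\{\theta\ge 0:\psi(\theta)=q\}$. For $q\ge 0$ let $W^{(q)}:\mathbb R\to[0,\infty)$ be the $q$-scale function of $X$: the unique function which vanishes on $(-\infty,0)$, is right-continuous on $[0,\infty)$, and satisfies $\int_0^\infty e^{-\beta x}W^{(q)}(x)\,dx=\frac{1}{\psi(\beta)-q}$ for all $\beta>\Phi(q)$ (exactly one such function exists). Write $W=W^{(0)}$, and let $W^{*k}$ be the $k$-th convolution power of $W$ (so $W^{*1}=W$). (1) For all $x\ge 0$ and all integers $k\ge 0$, $W^{*(k+1)}(x)\le \frac{x^k}{k!}W(x)^{k+1}$.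 For every $x\in\mathbb R$ the series $\sum_{k\ge 0}q^kW^{*(k+1)}(x)$ converges absolutely for every $q\in\mathbb C$, it is an entire function of $q$, and for every real $q\ge 0$ its sum is $W^{(q)}(x)$. Thus $q\mapsto W^{(q)}(x)$ extends to an entire function, and for $q\in\mathbb C$ we define $W^{(q)}(x):=\sum_{k\ge 0}q^kW^{*(k+1)}(x)$. (2) Let $c\in\mathbb R$ be such that $\psi(c)<\infty$, i.e. $E(e^{cX_1})<\infty$, and let $P^c$ be any measure on $(\Omega,\mathcal F)$ with $\frac{dP^c}{dP}\big|_{\mathcal F_t}=e^{cX_t-\psi(c)t}$ for all $t\ge 0$ (it is enough that this holds for $t=1$). Let $\psi_c(\theta)=\log E^c(e^{\theta X_1})$ be the Laplace exponent of $X$ under $P^c$. Then the scale functions $W_c^{(q)}$ of $(X,P^c)$, i.e. those defined from $\psi_c$ in place of $\psi$, exist and are unique for all $q\ge 0$, and all of (1) holds for them; with the resulting entire extensions, $$W^{(q)}(x)=e^{cx}\,W_c^{(q-\psi(c))}(x)\qquad\text{for all }q\in\mathbb C\text{ and all }x\ge 0.$$ -/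

import Mathlib

open MeasureTheory ProbabilityTheory Set Filter
open scoped NNReal ENNReal Topology Nat

/-- A measure `Λ` on `ℝ \ {0}` (seen as a measure on `ℝ` without mass at `0`) with
`∫ (1 ∧ x²) Λ(dx) < ∞`. -/
def IsLevyMeasure (Λ : Measure ℝ) : Prop :=
  Λ {0} = 0 ∧ ∫⁻ x, ENNReal.ofReal (min 1 (x ^ 2)) ∂Λ < ∞

/-- The Lévy–Khintchine exponent
`Ψ(θ) = iμθ + σ²θ²/2 + ∫ (1 - e^{iθx} + iθx 1_{|x|<1}) Λ(dx)`. -/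
noncomputable def levyKhintchineExponent (μ σ : ℝ) (Λ : Measure ℝ) (θ : ℝ) : ℂ :=
  Complex.I * μ * θ + (σ : ℂ) ^ 2 / 2 * (θ : ℂ) ^ 2 +
    ∫ x : ℝ, (1 - Complex.exp (Complex.I * θ * x) +
      (if |x| < 1 then Complex.I * θ * x else 0)) ∂Λ

/-- `X` is a (real-valued) Lévy process on the filtered probability space `(Ω, m, 𝓕, P)`:
adapted, with càdlàg paths, started from `0`, and with increments `X_t - X_s` that are
independent of `𝓕_s` and distributed as `X_{t-s}`. -/
structure IsLevyProcess {Ω : Type*} {m : MeasurableSpace Ω} (P : Measure Ω)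
    (𝓕 : Filtration ℝ≥0 m) (X : ℝ≥0 → Ω → ℝ) : Prop where
  adapted : ∀ t, Measurable[𝓕 t] (X t)
  right_continuous : ∀ ω t, ContinuousWithinAt (fun s => X s ω) (Ici t) t
  left_limits : ∀ ω t, ∃ l : ℝ, Tendsto (fun s => X s ω) (𝓝[<] t) (𝓝 l)
  start : ∀ᵐ ω ∂P, X 0 ω = 0
  indep_increments : ∀ s t, s ≤ t →
    Indep (MeasurableSpace.comap (fun ω => X t ω - X s ω) inferInstance) (𝓕 s) P
  stationary_increments : ∀ s t, s ≤ t →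
    IdentDistrib (fun ω => X t ω - X s ω) (X (t - s)) P P

/-- `X` is a spectrally negative Lévy process: its Lévy measure does not charge `(0, ∞)`, and
the paths of `X` are not (almost surely) monotone. -/
structure IsSpectrallyNegative {Ω : Type*} {m : MeasurableSpace Ω} (P : Measure Ω)
    (𝓕 : Filtration ℝ≥0 m) (X : ℝ≥0 → Ω → ℝ) : Prop extends IsLevyProcess P 𝓕 X where
  no_positive_jumps : ∃ (μ σ : ℝ) (Λ : Measure ℝ), IsLevyMeasure Λ ∧ Λ (Ioi 0) = 0 ∧
    ∀ (t : ℝ≥0) (θ : ℝ),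
      charFun (P.map (X t)) θ = Complex.exp (-(t : ℂ) * levyKhintchineExponent μ σ Λ θ)
  not_increasing : ¬ ∀ᵐ ω ∂P, Monotone (fun t => X t ω)
  not_decreasing : ¬ ∀ᵐ ω ∂P, Antitone (fun t => X t ω)

/-- The Laplace exponent `ψ(θ) = log E[e^{θ X_1}]` of `X` under `P`; it is finite at `θ` exactly
when `e^{θ X_1}` is integrable. -/
noncomputable def laplaceExponent {Ω : Type*} {m : MeasurableSpace Ω} (P : Measure Ω)
    (X : ℝ≥0 → Ω → ℝ) (θ : ℝ) : ℝ :=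
  cgf (X 1) P θ

/-- `Q` agrees on `𝓕_t` with the exponential change of measure `P^c`:
`dQ / dP = e^{c X_t - ψ(c) t}` on `𝓕_t`. -/
def IsExpChangeOfMeasure {Ω : Type*} {m : MeasurableSpace Ω} (P : Measure Ω)
    (𝓕 : Filtration ℝ≥0 m) (X : ℝ≥0 → Ω → ℝ) (c : ℝ) (t : ℝ≥0) (Q : Measure Ω) : Prop :=
  ∀ A, MeasurableSet[𝓕 t] A →
    Q A = ∫⁻ ω in A, ENNReal.ofReal (Real.exp (c * X t ω - laplaceExponent P X c * t)) ∂P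

/-- `Φ(q) = sup {θ ≥ 0 : ψ(θ) = q}`. -/
noncomputable def rightInverse (ψ : ℝ → ℝ) (q : ℝ) : ℝ :=
  sSup {θ : ℝ | 0 ≤ θ ∧ ψ θ = q}

/-- `W : ℝ → [0, ∞)` vanishes on `(-∞, 0)`, is right-continuous on `[0, ∞)` and has Laplace
transform `1 / (ψ(β) - q)` for `β > Φ(q)`. -/
structure IsScaleFunction (ψ : ℝ → ℝ) (q : ℝ) (W : ℝ → ℝ) : Prop where
  nonneg : ∀ x, 0 ≤ W x
  eq_zero : ∀ x < 0, W x = 0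
  right_continuous : ∀ x, 0 ≤ x → ContinuousWithinAt W (Ici x) x
  integrable : ∀ β, rightInverse ψ q < β →
    IntegrableOn (fun x => Real.exp (-β * x) * W x) (Ioi 0)
  laplace : ∀ β, rightInverse ψ q < β →
    ∫ x in Ioi 0, Real.exp (-β * x) * W x = 1 / (ψ β - q)

/-- The `q`-scale function `W^{(q)}` belonging to the Laplace exponent `ψ`, that is, the function
with the property `IsScaleFunction ψ q`. -/
noncomputable def scaleFunction (ψ : ℝ → ℝ) (q : ℝ) : ℝ → ℝ :=
  Classical.epsilon (IsScaleFunction ψ q)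

/-- `convPow W k` is the convolution power `W^{*(k+1)}`; so `convPow W 0 = W`. -/
noncomputable def convPow (W : ℝ → ℝ) : ℕ → ℝ → ℝ
  | 0 => W
  | k + 1 => convolution (convPow W k) W (ContinuousLinearMap.mul ℝ ℝ) volume

/-- `W^{(q)}(x)` for complex `q`, as the sum of the series `∑ q^k W^{*(k+1)}(x)`. -/
noncomputable def complexScaleFunction (ψ : ℝ → ℝ) (q : ℂ) (x : ℝ) : ℂ :=
  ∑' k : ℕ, q ^ k * (convPow (scaleFunction ψ 0) k x : ℂ)

/-- The `q`-scale functions of `ψ` are well defined for `q ≥ 0`, and `q ↦ W^{(q)}(x)` is extended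
from `[0, ∞)` to an entire function by the everywhere absolutely convergent series
`∑ q^k W^{*(k+1)}(x)`, whose coefficients satisfy `W^{*(k+1)}(x) ≤ x^k W(x)^{k+1} / k!`. -/
structure ScaleFunctionsExtend (ψ : ℝ → ℝ) : Prop where
  existsUnique : ∀ q : ℝ, 0 ≤ q → ∃! W, IsScaleFunction ψ q W
  bound : ∀ x, 0 ≤ x → ∀ k : ℕ,
    convPow (scaleFunction ψ 0) k x ≤ x ^ k / k ! * scaleFunction ψ 0 x ^ (k + 1)
  summable : ∀ (q : ℂ) (x : ℝ),
    Summable fun k : ℕ => ‖q ^ k * (convPow (scaleFunction ψ 0) k x : ℂ)‖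
  eq_series : ∀ q : ℝ, 0 ≤ q → ∀ x, (scaleFunction ψ q x : ℂ) = complexScaleFunction ψ q x
  entire : ∀ x, Differentiable ℂ fun q : ℂ => complexScaleFunction ψ q x

/-! Everything rests on one analytic fact: the 0-scale function exists and is increasing. Put `c =
Φ(0)`. By the Esscher transform, `θ ↦ ψ(c+θ)` is again the exponent of a Lévy–Khintchine triple
without positive jumps, and it is positive on `(0,∞)`. For such an exponent `ψ(θ)/θ = p + sθ + ∫
(e^{θx} - 1 - θx)/θ Λ(dx)` with `p ≥ 0`. This is a Bernstein function, so its reciprocal is the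
Laplace transform of a measure `U` on `[0,∞)` (`exists_potential`). To see this, approximate it by
functions `a - ν̂(θ)`, whose reciprocals are the transforms of `∑ ν^{*k}/a^{k+1}`, and pass to the
limit by tightness. Then `W(x) = e^{cx} U[0,x]` is increasing and has transform `1/ψ`
(`isScaleFunction_of_potential`).

Monotonicity of `W` gives the bound on `W^{*(k+1)}` by induction, hence an entire series. Its
Laplace transform is the geometric series `∑ q^k/ψ^{k+1} = 1/(ψ - q)`, so uniqueness of Laplace
transforms identifies its sum with `W^{(q)}` (`isScaleFunction_series`).

For the change of measure, `ψ_c(θ) = ψ(c+θ) - ψ(c)` for `θ ≥ 0`, which is once more a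
Lévy–Khintchine exponent. Comparing Laplace transforms gives the identity for real `q ≥ max(0,
ψ(c))`, and the identity theorem extends it to all complex `q` (`complexScaleFunction_tilt`).

The probabilistic input is twofold. The Lévy–Khintchine formula for the characteristic function has
to be continued to real exponents, including negative `c` (`expMoment_of_charFun`): the large jumps
form a compound Poisson factor, and the remaining factor has all exponential moments.
Non-monotonicity of the paths gives `ψ → ∞` (`tendsto_laplaceExponent`). -/

/-! ### Exponential moments of measures on the line -/

/-- The exponential moment `∫ e^{θx} μ(dx)`, with values in `[0, ∞]`. -/
noncomputable def expMoment (μ : Measure ℝ) (θ : ℝ) : ℝ≥0∞ :=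
  ∫⁻ x, ENNReal.ofReal (Real.exp (θ * x)) ∂μ

theorem expMoment_conv (μ ν : Measure ℝ) [SFinite ν] (θ : ℝ) :
    expMoment (μ ∗ ν) θ = expMoment μ θ * expMoment ν θ := by
  unfold expMoment
  rw [Measure.lintegral_conv (by fun_prop)]
  simp_rw [mul_add, Real.exp_add, ENNReal.ofReal_mul (Real.exp_nonneg _)]
  rw [← lintegral_mul_const _ (by fun_prop)]
  congr with x
  rw [lintegral_const_mul _ (by fun_prop)]

theorem expMoment_smul (a : ℝ≥0∞) (μ : Measure ℝ) (θ : ℝ) :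
    expMoment (a • μ) θ = a * expMoment μ θ := by
  simp [expMoment, lintegral_smul_measure]

theorem expMoment_add (μ ν : Measure ℝ) (θ : ℝ) :
    expMoment (μ + ν) θ = expMoment μ θ + expMoment ν θ := by
  simp [expMoment, lintegral_add_measure]

theorem expMoment_sum {ι : Type*} (μ : ι → Measure ℝ) (θ : ℝ) :
    expMoment (Measure.sum μ) θ = ∑' i, expMoment (μ i) θ := by
  simp [expMoment, lintegral_sum_measure]

theorem expMoment_dirac (a θ : ℝ) :
    expMoment (Measure.dirac a) θ = ENNReal.ofReal (Real.exp (θ * a)) := by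
  simp [expMoment]

theorem expMoment_zero (μ : Measure ℝ) : expMoment μ 0 = μ univ := by
  simp [expMoment]

theorem expMoment_withDensity_exp (μ : Measure ℝ) (a θ : ℝ) :
    expMoment (μ.withDensity fun x => ENNReal.ofReal (Real.exp (a * x))) θ =
      expMoment μ (a + θ) := by
  unfold expMoment
  rw [lintegral_withDensity_eq_lintegral_mul _ (by fun_prop) (by fun_prop)]
  simp [Pi.mul_apply, ← ENNReal.ofReal_mul (Real.exp_nonneg _), ← Real.exp_add, add_mul]

theorem expMoment_mono_of_nonneg {μ : Measure ℝ} (hμ : ∀ᵐ x ∂μ, 0 ≤ x) {a b : ℝ} (hab : a ≤ b) :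
    expMoment μ a ≤ expMoment μ b := by
  refine lintegral_mono_ae ?_
  filter_upwards [hμ] with x hx
  gcongr

/-! ### Convolution powers of a measure -/

/-- The `k`-fold convolution power of a measure on `ℝ`. -/
noncomputable def Measure.convPower (ν : Measure ℝ) : ℕ → Measure ℝ
  | 0 => Measure.dirac 0
  | k + 1 => Measure.convPower ν k ∗ ν

instance (ν : Measure ℝ) [IsFiniteMeasure ν] (k : ℕ) : IsFiniteMeasure (Measure.convPower ν k) := by
  induction k with
  | zero => unfold Measure.convPower; infer_instance
  | succ k ih => unfold Measure.convPower; infer_instance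

theorem expMoment_convPower (ν : Measure ℝ) [SFinite ν] (k : ℕ) (θ : ℝ) :
    expMoment (Measure.convPower ν k) θ = expMoment ν θ ^ k := by
  induction k with
  | zero => simp [Measure.convPower, expMoment_dirac]
  | succ k ih => rw [Measure.convPower, expMoment_conv, ih, pow_succ]

theorem ae_nonneg_conv {μ ν : Measure ℝ} [SFinite ν] (hμ : ∀ᵐ x ∂μ, 0 ≤ x)
    (hν : ∀ᵐ x ∂ν, 0 ≤ x) : ∀ᵐ x ∂(μ ∗ ν), 0 ≤ x := by
  have hm : Measurable ((Iio (0 : ℝ)).indicator (fun _ => (1 : ℝ≥0∞))) :=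
    measurable_const.indicator measurableSet_Iio
  have : (μ ∗ ν) (Iio 0) = 0 := by
    rw [← lintegral_indicator_one measurableSet_Iio, Pi.one_def, Measure.lintegral_conv hm]
    refine lintegral_eq_zero_of_ae_eq_zero ?_
    filter_upwards [hμ] with x hx
    refine lintegral_eq_zero_of_ae_eq_zero ?_
    filter_upwards [hν] with y hy
    simp only [Pi.zero_apply, indicator_apply_eq_zero, mem_Iio]
    intro h; linarith
  rw [ae_iff]
  simpa [Iio, not_le] using this

theorem ae_nonneg_convPower {ν : Measure ℝ} [SFinite ν] (hν : ∀ᵐ x ∂ν, 0 ≤ x) (k : ℕ) :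
    ∀ᵐ x ∂(Measure.convPower ν k), 0 ≤ x := by
  induction k with
  | zero => rw [Measure.convPower, ae_dirac_iff (measurableSet_Ici)]
  | succ k ih => exact ae_nonneg_conv ih hν

/-- The measure `∑ ν^{*k} / a^{k+1}`, with Laplace transform `1 / (a - ν̂)`. -/
noncomputable def Measure.resolvent (a : ℝ≥0∞) (ν : Measure ℝ) : Measure ℝ :=
  Measure.sum fun k : ℕ => (a⁻¹ ^ (k + 1)) • Measure.convPower ν k

/-- A geometric series. Truncated subtraction is harmless: if `ν̂(θ) ≥ a`, the series diverges and
the right-hand side is `0⁻¹ = ∞`. -/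
theorem expMoment_resolvent {a : ℝ≥0∞} (ha : a ≠ 0) (ha' : a ≠ ∞) (ν : Measure ℝ) [SFinite ν]
    (θ : ℝ) : expMoment (Measure.resolvent a ν) θ = (a - expMoment ν θ)⁻¹ := by
  have h : a - expMoment ν θ = a * (1 - a⁻¹ * expMoment ν θ) := by
    rw [ENNReal.mul_sub (fun _ _ => ha'), ← mul_assoc, ENNReal.mul_inv_cancel ha ha']
    simp
  rw [h, ENNReal.mul_inv (Or.inl ha) (Or.inl ha'), ← ENNReal.tsum_geometric,
    ← ENNReal.tsum_mul_left, Measure.resolvent, expMoment_sum]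
  congr with k
  rw [expMoment_smul, expMoment_convPower]
  ring

theorem ae_nonneg_resolvent (a : ℝ≥0∞) {ν : Measure ℝ} [SFinite ν] (hν : ∀ᵐ x ∂ν, 0 ≤ x) :
    ∀ᵐ x ∂(Measure.resolvent a ν), 0 ≤ x := by
  rw [Measure.resolvent, Measure.ae_sum_iff]
  exact fun k => Measure.ae_smul_measure (ae_nonneg_convPower hν k) _

/-! ### Weak limits of probability measures with bounded exponential moments -/

theorem measure_compl_Icc_le_expMoment (μ : Measure ℝ) {δ : ℝ} (hδ : 0 < δ) (R : ℝ) :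
    μ (Icc (-R) R)ᶜ ≤
      (expMoment μ δ + expMoment μ (-δ)) / ENNReal.ofReal (Real.exp (δ * R)) := by
  unfold expMoment
  rw [← lintegral_add_left (by fun_prop)]
  refine le_trans (measure_mono ?_) (meas_ge_le_lintegral_div (by fun_prop) (by simp [Real.exp_pos])
    ENNReal.ofReal_ne_top)
  intro x hx
  simp only [mem_compl_iff, mem_Icc, not_and_or, not_le] at hx
  rcases hx with hx | hx
  · refine le_add_left (ENNReal.ofReal_le_ofReal (Real.exp_le_exp.2 ?_))
    nlinarith
  · refine le_add_right (ENNReal.ofReal_le_ofReal (Real.exp_le_exp.2 ?_))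
    nlinarith

theorem isTightMeasureSet_of_expMoment_le {S : Set (Measure ℝ)} {δ : ℝ} (hδ : 0 < δ) {C : ℝ≥0∞}
    (hC : C ≠ ∞) (h₁ : ∀ μ ∈ S, expMoment μ δ ≤ C) (h₂ : ∀ μ ∈ S, expMoment μ (-δ) ≤ C) :
    IsTightMeasureSet S := by
  rw [isTightMeasureSet_iff_exists_isCompact_measure_compl_le]
  intro ε hε
  have hlim : Tendsto (fun R : ℝ => (C + C) / ENNReal.ofReal (Real.exp (δ * R))) atTop (𝓝 0) := by
    have : Tendsto (fun R : ℝ => ENNReal.ofReal (Real.exp (δ * R))) atTop (𝓝 ∞) :=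
      ENNReal.tendsto_ofReal_atTop.comp (Real.tendsto_exp_atTop.comp
        (tendsto_id.const_mul_atTop hδ))
    simpa using ENNReal.Tendsto.div (tendsto_const_nhds (x := C + C)) (by simp) this (by simp [hC])
  obtain ⟨R, hR⟩ := (hlim.eventually (gt_mem_nhds hε)).exists
  refine ⟨Icc (-R) R, isCompact_Icc, fun μ hμ => ?_⟩
  refine (measure_compl_Icc_le_expMoment μ hδ R).trans (le_trans ?_ hR.le)
  gcongr
  · exact h₁ μ hμ
  · exact h₂ μ hμ

/-- Prokhorov's theorem. Taking the limit along a fixed ultrafilter finer than `atTop` replaces the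
passage to a subsequence. -/
theorem exists_tendsto_of_expMoment_le {μ : ℕ → ProbabilityMeasure ℝ} {δ : ℝ} (hδ : 0 < δ)
    {C : ℝ≥0∞} (hC : C ≠ ∞) (h₁ : ∀ n, expMoment (μ n) δ ≤ C)
    (h₂ : ∀ n, expMoment (μ n) (-δ) ≤ C) :
    ∃ ν : ProbabilityMeasure ℝ, Tendsto μ (hyperfilter ℕ) (𝓝 ν) := by
  have ht : IsTightMeasureSet {((ρ : ProbabilityMeasure ℝ) : Measure ℝ) | ρ ∈ range μ} := by
    refine isTightMeasureSet_of_expMoment_le hδ hC ?_ ?_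
    · rintro _ ⟨_, ⟨n, rfl⟩, rfl⟩; exact h₁ n
    · rintro _ ⟨_, ⟨n, rfl⟩, rfl⟩; exact h₂ n
  obtain ⟨ν, -, hν⟩ := (isCompact_closure_of_isTightMeasureSet ht).ultrafilter_le_nhds
    ((hyperfilter ℕ).map μ) (by
      simp only [Ultrafilter.coe_map, le_principal_iff, mem_map]
      exact Filter.univ_mem' fun n => subset_closure ⟨n, rfl⟩)
  exact ⟨ν, hν⟩

/-- Weak convergence only tests bounded functions. The bound at `2θ` makes `e^{θx}` uniformly
integrable, which allows it to be truncated at a level `K`. -/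
theorem expMoment_eq_of_tendsto {l : Filter ℕ} [l.NeBot] {μ : ℕ → ProbabilityMeasure ℝ}
    {ν : ProbabilityMeasure ℝ} (hμ : Tendsto μ l (𝓝 ν)) {θ : ℝ} {C L : ℝ≥0∞} (hC : C ≠ ∞)
    (hb : ∀ n, expMoment (μ n) (2 * θ) ≤ C)
    (hL : Tendsto (fun n => expMoment (μ n) θ) l (𝓝 L)) : expMoment ν θ = L := by
  have hexp : ∀ x : ℝ, ((Real.exp (θ * x)).toNNReal : ℝ≥0∞) = ENNReal.ofReal (Real.exp (θ * x)) :=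
    fun x => rfl
  let f : ℝ≥0 → BoundedContinuousFunction ℝ ℝ≥0 := fun K =>
    BoundedContinuousFunction.mkOfBound
      ⟨fun x => min (Real.exp (θ * x)).toNNReal K, by fun_prop⟩ K (fun x y => by
        rw [NNReal.dist_eq, abs_le]
        have h1 : ((min (Real.exp (θ * x)).toNNReal K : ℝ≥0) : ℝ) ≤ K := by
          exact_mod_cast min_le_right _ _
        have h2 : ((min (Real.exp (θ * y)).toNNReal K : ℝ≥0) : ℝ) ≤ K := by
          exact_mod_cast min_le_right _ _
        have h3 := NNReal.coe_nonneg (min (Real.exp (θ * x)).toNNReal K)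
        have h4 := NNReal.coe_nonneg (min (Real.exp (θ * y)).toNNReal K)
        constructor <;> simp only [ContinuousMap.coe_mk] <;> linarith)
  have hf : ∀ K x, (f K x : ℝ≥0∞) = min (ENNReal.ofReal (Real.exp (θ * x))) K := fun K x => by
    change ((min (Real.exp (θ * x)).toNNReal K : ℝ≥0) : ℝ≥0∞) = _
    rw [ENNReal.coe_min, hexp]
  have hlim : ∀ K : ℝ≥0, Tendsto (fun n => ∫⁻ x, f K x ∂(μ n : Measure ℝ)) l
      (𝓝 (∫⁻ x, f K x ∂(ν : Measure ℝ))) := fun K =>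
    ProbabilityMeasure.tendsto_iff_forall_lintegral_tendsto.1 hμ (f K)
  have hle : ∀ (K : ℝ≥0) (ρ : Measure ℝ), ∫⁻ x, f K x ∂ρ ≤ expMoment ρ θ := fun K ρ => by
    refine lintegral_mono fun x => ?_
    rw [hf]; exact min_le_left _ _
  apply le_antisymm
  · have hsup : Tendsto (fun n : ℕ => ∫⁻ x, f n x ∂(ν : Measure ℝ)) atTop
        (𝓝 (expMoment ν θ)) := by
      refine lintegral_tendsto_of_tendsto_of_monotone (fun n => by fun_prop) ?_ ?_
      · refine ae_of_all _ fun x m n hmn => ?_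
        simp only [hf]
        gcongr
      · refine ae_of_all _ fun x => ?_
        refine tendsto_const_nhds.congr' ?_
        filter_upwards [eventually_ge_atTop ⌈Real.exp (θ * x)⌉₊] with n hn
        rw [hf, min_eq_left]
        refine ENNReal.ofReal_le_of_le_toReal ?_
        simpa using (Nat.le_ceil _).trans (Nat.cast_le.2 hn)
    refine le_of_tendsto' hsup fun K => ?_
    exact le_of_tendsto_of_tendsto' (hlim K) hL fun n => hle _ _
  · have hK : ∀ K : ℝ≥0, 0 < K → L ≤ expMoment ν θ + C / K := by
      intro K hK
      refine le_trans ?_ (add_le_add (hle K ν) le_rfl)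
      refine le_of_tendsto_of_tendsto' hL ((hlim K).add tendsto_const_nhds) fun n => ?_
      have hCK : expMoment (μ n) (2 * θ) / K ≤ C / K := by gcongr; exact hb n
      refine le_trans ?_ (add_le_add le_rfl hCK)
      unfold expMoment
      simp_rw [div_eq_mul_inv]
      rw [← lintegral_mul_const _ (by fun_prop), ← lintegral_add_left (by fun_prop)]
      refine lintegral_mono fun x => ?_
      rw [hf]
      rcases le_total (ENNReal.ofReal (Real.exp (θ * x))) K with h | h
      · rw [min_eq_left h]; exact le_self_add
      -- Where `e^{θx} ≥ K`, one has `e^{θx} ≤ e^{2θx}/K`.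
      · refine le_add_left ?_
        rw [← div_eq_mul_inv, ENNReal.le_div_iff_mul_le (by simp [hK.ne']) (by simp), mul_assoc,
          two_mul, Real.exp_add, ENNReal.ofReal_mul (Real.exp_nonneg _)]
        gcongr
    have hlimK : Tendsto (fun n : ℕ => expMoment ν θ + C / ((n + 1 : ℕ) : ℝ≥0)) atTop
        (𝓝 (expMoment ν θ + 0)) := by
      refine tendsto_const_nhds.add ?_
      have : Tendsto (fun n : ℕ => C / ((n + 1 : ℕ) : ℝ≥0∞)) atTop (𝓝 0) :=
        (ENNReal.Tendsto.const_div ENNReal.tendsto_nat_nhds_top (Or.inr hC) |>.comp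
          (tendsto_add_atTop_nat 1)).trans (by simp)
      simpa using this
    rw [add_zero] at hlimK
    exact ge_of_tendsto' hlimK fun n => hK _ (by positivity)

theorem ae_nonneg_of_tendsto {l : Filter ℕ} [l.NeBot] {μ : ℕ → ProbabilityMeasure ℝ}
    {ν : ProbabilityMeasure ℝ} (hμ : Tendsto μ l (𝓝 ν))
    (h : ∀ n, ∀ᵐ x ∂(μ n : Measure ℝ), 0 ≤ x) : ∀ᵐ x ∂(ν : Measure ℝ), 0 ≤ x := by
  have h0 : ∀ n, (μ n : Measure ℝ) (Iio 0) = 0 := fun n => by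
    have := h n
    rw [ae_iff] at this
    simpa [Iio, not_le] using this
  have := ProbabilityMeasure.le_liminf_measure_open_of_tendsto hμ (isOpen_Iio (a := (0 : ℝ)))
  simp only [h0, liminf_const, nonpos_iff_eq_zero] at this
  rw [ae_iff]
  simpa [Iio, not_le] using this

/-! ### Uniqueness of Laplace transforms -/

/-- Stone–Weierstrass: `e^{-x}` separates the points of `[0,∞)`, and integrals of polynomials in
`e^{-x}` only involve the transform at natural numbers. -/
theorem eq_of_expMoment_neg_nat_eq {μ ν : Measure ℝ} [IsFiniteMeasure μ] [IsFiniteMeasure ν]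
    (hμ : ∀ᵐ x ∂μ, 0 ≤ x) (hν : ∀ᵐ x ∂ν, 0 ≤ x)
    (h : ∀ n : ℕ, expMoment μ (-n) = expMoment ν (-n)) : μ = ν := by
  let e : BoundedContinuousFunction ℝ≥0 ℝ := BoundedContinuousFunction.mkOfBound
    ⟨fun x => Real.exp (-(x : ℝ)), by fun_prop⟩ 1 (fun x y => by
      have hx := Real.exp_le_one_iff.2 (neg_nonpos.2 x.2)
      have hy := Real.exp_le_one_iff.2 (neg_nonpos.2 y.2)
      have hx' := Real.exp_pos (-(x : ℝ))
      have hy' := Real.exp_pos (-(y : ℝ))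
      rw [Real.dist_eq, abs_le]
      simp only [ContinuousMap.coe_mk]
      constructor <;> linarith [show Real.exp (-(x : ℝ)) ≤ 1 from hx,
        show Real.exp (-(y : ℝ)) ≤ 1 from hy])
  have he : ∀ x, e x = Real.exp (-(x : ℝ)) := fun x => rfl
  have key : μ.map Real.toNNReal = ν.map Real.toNNReal := by
    let A : StarSubalgebra ℝ (BoundedContinuousFunction ℝ≥0 ℝ) :=
      { Algebra.adjoin ℝ {e} with
        star_mem' := fun {a} ha => by
          have : star a = a := by ext x; simp
          rwa [this] }
    refine ext_of_forall_mem_subalgebra_integral_eq_of_pseudoEMetric_complete_countable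
      (𝕜 := ℝ) (A := A) ?_ ?_
    · intro x y hxy
      refine ⟨e, ⟨e.toContinuousMap, ⟨e, Algebra.subset_adjoin rfl, rfl⟩, rfl⟩, ?_⟩
      rw [he, he]
      intro h'
      exact hxy (NNReal.coe_injective (neg_injective (Real.exp_injective h')))
    · intro g hg
      replace hg : g ∈ Algebra.adjoin ℝ {e} := hg
      rw [Algebra.adjoin_singleton_eq_range_aeval] at hg
      obtain ⟨p, rfl⟩ := hg
      have hev : ∀ x, (Polynomial.aeval e p : BoundedContinuousFunction ℝ≥0 ℝ) x =
          ∑ i ∈ Finset.range (p.natDegree + 1), p.coeff i * Real.exp (-(i : ℝ) * x) := fun x => by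
        rw [Polynomial.aeval_eq_sum_range, BoundedContinuousFunction.sum_apply]
        refine Finset.sum_congr rfl fun i _ => ?_
        simp only [BoundedContinuousFunction.coe_smul, BoundedContinuousFunction.coe_pow,
          Pi.pow_apply, smul_eq_mul, he]
        rw [← Real.exp_nat_mul]
        ring_nf
      have hint : ∀ (ρ : Measure ℝ) [IsFiniteMeasure ρ] (i : ℕ),
          Integrable (fun x : ℝ≥0 => p.coeff i * Real.exp (-(i : ℝ) * x))
            (ρ.map Real.toNNReal) := fun ρ _ i => by
        refine Integrable.const_mul ?_ _
        refine Integrable.of_bound (by fun_prop) 1 (ae_of_all _ fun x => ?_)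
        rw [Real.norm_of_nonneg (Real.exp_nonneg _), Real.exp_le_one_iff]
        have : 0 ≤ (i : ℝ) * x := by positivity
        linarith
      have hval : ∀ (ρ : Measure ℝ) [IsFiniteMeasure ρ] (i : ℕ), (∀ᵐ x ∂ρ, 0 ≤ x) →
          ∫ x : ℝ≥0, Real.exp (-(i : ℝ) * x) ∂(ρ.map Real.toNNReal) =
            (expMoment ρ (-i)).toReal := fun ρ _ i hρ => by
        rw [integral_eq_lintegral_of_nonneg_ae (ae_of_all _ fun x => Real.exp_nonneg _)
          (by fun_prop), lintegral_map (by fun_prop) (by fun_prop)]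
        congr 1
        refine lintegral_congr_ae ?_
        filter_upwards [hρ] with x hx
        rw [Real.coe_toNNReal x hx]
      change ∫ x, (Polynomial.aeval e p : BoundedContinuousFunction ℝ≥0 ℝ) x ∂_ =
        ∫ x, (Polynomial.aeval e p : BoundedContinuousFunction ℝ≥0 ℝ) x ∂_
      simp_rw [hev]
      rw [integral_finsetSum _ fun i _ => hint μ i, integral_finsetSum _ fun i _ => hint ν i]
      refine Finset.sum_congr rfl fun i _ => ?_
      rw [integral_const_mul, integral_const_mul, hval μ i hμ, hval ν i hν, h]
  have hback : ∀ ρ : Measure ℝ, (∀ᵐ x ∂ρ, 0 ≤ x) →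
      (ρ.map Real.toNNReal).map ((↑) : ℝ≥0 → ℝ) = ρ := fun ρ hρ => by
    rw [Measure.map_map (by fun_prop) (by fun_prop)]
    conv_rhs => rw [← Measure.map_id (μ := ρ)]
    refine Measure.map_congr ?_
    filter_upwards [hρ] with x hx
    simp [hx]
  rw [← hback μ hμ, key, hback ν hν]

theorem withDensity_exp_withDensity_exp_neg (μ : Measure ℝ) (a : ℝ) :
    (μ.withDensity fun x => ENNReal.ofReal (Real.exp (a * x))).withDensity
      (fun x => ENNReal.ofReal (Real.exp (-a * x))) = μ := by
  rw [← withDensity_mul _ (by fun_prop) (by fun_prop)]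
  conv_rhs => rw [← withDensity_one (μ := μ)]
  congr 1 with x
  rw [Pi.mul_apply, ← ENNReal.ofReal_mul (Real.exp_nonneg _), ← Real.exp_add]
  simp

theorem ae_withDensity_of_ae {μ : Measure ℝ} {p : ℝ → Prop} (h : ∀ᵐ x ∂μ, p x)
    (f : ℝ → ℝ≥0∞) : ∀ᵐ x ∂(μ.withDensity f), p x :=
  (withDensity_absolutelyContinuous μ f).ae_le h

/-- The weight `e^{-β₀x}` makes both measures finite and shifts their transforms by `β₀`; it is then
divided out again. -/
theorem eq_of_expMoment_neg_eq {μ ν : Measure ℝ} (hμ : ∀ᵐ x ∂μ, 0 ≤ x) (hν : ∀ᵐ x ∂ν, 0 ≤ x)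
    {β₀ : ℝ} (hfin : expMoment μ (-β₀) ≠ ∞)
    (h : ∀ β, β₀ ≤ β → expMoment μ (-β) = expMoment ν (-β)) : μ = ν := by
  rw [← withDensity_exp_withDensity_exp_neg μ (-β₀), ← withDensity_exp_withDensity_exp_neg ν (-β₀)]
  have h0 : ∀ ρ : Measure ℝ, (ρ.withDensity fun x => ENNReal.ofReal (Real.exp (-β₀ * x))) univ =
      expMoment ρ (-β₀) := fun ρ => by
    rw [← expMoment_zero, expMoment_withDensity_exp, add_zero]
  have : IsFiniteMeasure (μ.withDensity fun x => ENNReal.ofReal (Real.exp (-β₀ * x))) :=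
    ⟨by rw [h0]; exact hfin.lt_top⟩
  have : IsFiniteMeasure (ν.withDensity fun x => ENNReal.ofReal (Real.exp (-β₀ * x))) :=
    ⟨by rw [h0, ← h _ le_rfl]; exact hfin.lt_top⟩
  congr 1
  refine eq_of_expMoment_neg_nat_eq (ae_withDensity_of_ae hμ _) (ae_withDensity_of_ae hν _)
    fun n => ?_
  rw [expMoment_withDensity_exp, expMoment_withDensity_exp, ← neg_add]
  exact h _ (by simp)

/-! ### Limits of Laplace transforms -/

/-- Weighting `U n` by `e^{-2εx}/G n (2ε)` gives probability measures. The shift `2ε`, rather than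
`ε`, leaves room for a bounded exponential moment at `ε > 0`, which gives tightness. The limit is
then freed of the weight. -/
theorem exists_measure_of_tendsto_expMoment_aux {U : ℕ → Measure ℝ} (h0 : ∀ n, ∀ᵐ x ∂U n, 0 ≤ x)
    {g : ℝ → ℝ} {G : ℕ → ℝ → ℝ} (hG : ∀ n θ, 0 < θ → 0 < G n θ)
    (hU : ∀ n θ, 0 < θ → expMoment (U n) (-θ) = ENNReal.ofReal (G n θ))
    (hg : ∀ θ, 0 < θ → 0 < g θ) (hlim : ∀ θ, 0 < θ → Tendsto (fun n => G n θ) atTop (𝓝 (g θ)))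
    {ε : ℝ} (hε : 0 < ε) :
    ∃ V : Measure ℝ, SFinite V ∧ (∀ᵐ x ∂V, 0 ≤ x) ∧
      ∀ θ, 2 * ε ≤ θ → expMoment V (-θ) = ENNReal.ofReal (g θ) := by
  let M : ℕ → Measure ℝ := fun n => (ENNReal.ofReal (G n (2 * ε)))⁻¹ •
    (U n).withDensity fun x => ENNReal.ofReal (Real.exp (-(2 * ε) * x))
  have hM : ∀ n η, η < 2 * ε → expMoment (M n) η =
      ENNReal.ofReal (G n (2 * ε - η) / G n (2 * ε)) := fun n η hη => by
    rw [expMoment_smul, expMoment_withDensity_exp,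
      show -(2 * ε) + η = -(2 * ε - η) by ring, hU n _ (by linarith),
      ENNReal.ofReal_div_of_pos (hG n _ (by linarith)), mul_comm, div_eq_mul_inv]
  have hM0 : ∀ n, expMoment (M n) 0 = 1 := fun n => by
    rw [hM n 0 (by linarith), sub_zero, div_self (hG n _ (by linarith)).ne', ENNReal.ofReal_one]
  have hMnn : ∀ n, ∀ᵐ x ∂M n, 0 ≤ x := fun n =>
    Measure.ae_smul_measure (ae_withDensity_of_ae (h0 n) _) _
  let μ : ℕ → ProbabilityMeasure ℝ := fun n => ⟨M n, ⟨by rw [← expMoment_zero, hM0]⟩⟩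
  have hlimM : ∀ η, η < 2 * ε → Tendsto (fun n => G n (2 * ε - η) / G n (2 * ε)) atTop
      (𝓝 (g (2 * ε - η) / g (2 * ε))) := fun η hη =>
    (hlim _ (by linarith)).div (hlim _ (by linarith)) (hg _ (by linarith)).ne'
  obtain ⟨C, hC⟩ := (hlimM ε (by linarith)).bddAbove_range
  have hneg : ∀ n η, η ≤ 0 → expMoment (M n) η ≤ 1 := fun n η hη =>
    (expMoment_mono_of_nonneg (hMnn n) hη).trans (hM0 n).le
  obtain ⟨ν, hν⟩ := exists_tendsto_of_expMoment_le (μ := μ) hε (C := ENNReal.ofReal C + 1)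
    (by simp) (fun n => by
      refine le_trans ?_ le_self_add
      change expMoment (M n) ε ≤ _
      rw [hM n ε (by linarith)]
      exact ENNReal.ofReal_le_ofReal (hC ⟨n, rfl⟩))
    (fun n => le_add_left (hneg n _ (by linarith)))
  have hE : ∀ η, η ≤ 0 →
      expMoment ν η = ENNReal.ofReal (g (2 * ε - η) / g (2 * ε)) := fun η hη => by
    refine expMoment_eq_of_tendsto hν (C := 1) (by simp) (fun n => hneg n _ (by linarith)) ?_
    refine Tendsto.mono_left ?_ Nat.hyperfilter_le_atTop
    change Tendsto (fun n => expMoment (M n) η) _ _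
    simp_rw [fun n => hM n η (by linarith)]
    exact ENNReal.tendsto_ofReal (hlimM η (by linarith))
  refine ⟨ENNReal.ofReal (g (2 * ε)) • (ν : Measure ℝ).withDensity
    fun x => ENNReal.ofReal (Real.exp (2 * ε * x)), inferInstance, ?_, fun θ hθ => ?_⟩
  · exact Measure.ae_smul_measure (ae_withDensity_of_ae (ae_nonneg_of_tendsto hν hMnn) _) _
  · have hgp := hg (2 * ε) (by linarith)
    rw [expMoment_smul, expMoment_withDensity_exp, hE _ (by linarith),
      ← ENNReal.ofReal_mul hgp.le]
    congr 1
    rw [mul_div_cancel₀ _ hgp.ne']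
    ring_nf

theorem exists_measure_of_tendsto_expMoment {U : ℕ → Measure ℝ} (h0 : ∀ n, ∀ᵐ x ∂U n, 0 ≤ x)
    {g : ℝ → ℝ} {G : ℕ → ℝ → ℝ} (hG : ∀ n θ, 0 < θ → 0 < G n θ)
    (hU : ∀ n θ, 0 < θ → expMoment (U n) (-θ) = ENNReal.ofReal (G n θ))
    (hg : ∀ θ, 0 < θ → 0 < g θ)
    (hlim : ∀ θ, 0 < θ → Tendsto (fun n => G n θ) atTop (𝓝 (g θ))) :
    ∃ V : Measure ℝ, SFinite V ∧ (∀ᵐ x ∂V, 0 ≤ x) ∧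
      ∀ θ, 0 < θ → expMoment V (-θ) = ENNReal.ofReal (g θ) := by
  obtain ⟨V, hV, hV0, hVE⟩ :=
    exists_measure_of_tendsto_expMoment_aux h0 hG hU hg hlim one_pos
  refine ⟨V, hV, hV0, fun θ hθ => ?_⟩
  -- With this `ε` the measure `V'` has the right transform at `θ` and also on `[2,∞)`, where it
  -- agrees with that of `V`.
  obtain ⟨V', -, hV0', hVE'⟩ := exists_measure_of_tendsto_expMoment_aux h0 hG hU hg hlim
    (ε := min (θ / 2) 1) (by positivity)
  have : V = V' := by
    refine eq_of_expMoment_neg_eq (β₀ := 2) hV0 hV0' ?_ fun β hβ => ?_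
    · rw [hVE 2 (by norm_num)]; exact ENNReal.ofReal_ne_top
    · rw [hVE β (by linarith), hVE' β (by linarith [min_le_right (θ / 2) 1])]
  rw [this, hVE' θ (by linarith [min_le_left (θ / 2) 1])]

/-! ### Compound Poisson laws -/

/-- The compound Poisson law with Lévy measure `ν`. -/
noncomputable def Measure.compoundPoisson (ν : Measure ℝ) : Measure ℝ :=
  ENNReal.ofReal (Real.exp (-ν.real univ)) •
    Measure.sum fun k : ℕ => ENNReal.ofReal (1 / k !) • Measure.convPower ν k

theorem expMoment_compoundPoisson {ν : Measure ℝ} [IsFiniteMeasure ν] {c r : ℝ} (hr : 0 ≤ r)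
    (h : expMoment ν c = ENNReal.ofReal r) :
    expMoment (Measure.compoundPoisson ν) c = ENNReal.ofReal (Real.exp (r - ν.real univ)) := by
  have hs : HasSum (fun k : ℕ => r ^ k / k !) (Real.exp r) := by
    rw [Real.exp_eq_exp_ℝ]
    exact NormedSpace.expSeries_div_hasSum_exp r
  rw [Measure.compoundPoisson, expMoment_smul, expMoment_sum, sub_eq_neg_add, Real.exp_add,
    ENNReal.ofReal_mul (Real.exp_nonneg _), ← hs.tsum_eq,
    ENNReal.ofReal_tsum_of_nonneg (fun k => by positivity) hs.summable]
  congr 2 with k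
  rw [expMoment_smul, expMoment_convPower, h, ← ENNReal.ofReal_pow hr,
    ← ENNReal.ofReal_mul (by positivity)]
  congr 1
  ring

/-- The term of exactly one jump. It shows that a finite moment of the compound Poisson law forces a
finite moment of its Lévy measure. -/
theorem expMoment_le_compoundPoisson (ν : Measure ℝ) [IsFiniteMeasure ν] (c : ℝ) :
    ENNReal.ofReal (Real.exp (-ν.real univ)) * expMoment ν c ≤
      expMoment (Measure.compoundPoisson ν) c := by
  rw [Measure.compoundPoisson, expMoment_smul, expMoment_sum]
  gcongr
  refine le_trans (le_of_eq ?_) (ENNReal.le_tsum 1)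
  rw [expMoment_smul, expMoment_convPower]
  simp

instance (ν : Measure ℝ) [IsFiniteMeasure ν] : IsProbabilityMeasure (Measure.compoundPoisson ν) := by
  refine ⟨?_⟩
  have : expMoment ν 0 = ENNReal.ofReal (ν.real univ) := by
    rw [expMoment_zero, ofReal_measureReal]
  rw [← expMoment_zero, expMoment_compoundPoisson measureReal_nonneg this]
  simp

theorem charFun_convPower (ν : Measure ℝ) [IsFiniteMeasure ν] (k : ℕ) (t : ℝ) :
    charFun (Measure.convPower ν k) t = charFun ν t ^ k := by
  induction k with
  | zero => simp [Measure.convPower, charFun_apply_real]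
  | succ k ih => rw [Measure.convPower, charFun_conv, ih, pow_succ]

theorem charFun_compoundPoisson (ν : Measure ℝ) [IsFiniteMeasure ν] (t : ℝ) :
    charFun (Measure.compoundPoisson ν) t =
      Complex.exp (∫ x, (Complex.exp (Complex.I * t * x) - 1) ∂ν) := by
  have hint : ∀ (ρ : Measure ℝ) [IsFiniteMeasure ρ],
      Integrable (fun x : ℝ => Complex.exp (t * x * Complex.I)) ρ := fun ρ _ => by
    refine Integrable.of_bound (by fun_prop) 1 (ae_of_all _ fun x => ?_)
    rw [← Complex.ofReal_mul, Complex.norm_exp_ofReal_mul_I]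
  set S : Measure ℝ := Measure.sum fun k : ℕ => ENNReal.ofReal (1 / k !) • Measure.convPower ν k
    with hS
  have hCP : Measure.compoundPoisson ν = ENNReal.ofReal (Real.exp (-ν.real univ)) • S := rfl
  -- A positive multiple of `S` has mass one.
  have hSfin : IsFiniteMeasure S := by
    refine ⟨?_⟩
    have h1 : (Measure.compoundPoisson ν) univ = 1 := measure_univ
    rw [hCP, Measure.smul_apply, smul_eq_mul] at h1
    refine lt_top_iff_ne_top.2 fun htop => ?_
    rw [htop, ENNReal.mul_top (by simp [Real.exp_pos])] at h1
    simp at h1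
  have hsum := hasSum_integral_measure (hint S)
  have hterm : ∀ k : ℕ, ∫ x : ℝ, Complex.exp (t * x * Complex.I)
      ∂(ENNReal.ofReal (1 / k !) • Measure.convPower ν k) = charFun ν t ^ k / k ! := fun k => by
    rw [integral_smul_measure, ← charFun_apply_real, charFun_convPower,
      ENNReal.toReal_ofReal (by positivity), Complex.real_smul]
    push_cast
    ring
  simp_rw [hterm] at hsum
  have hexp : charFun S t = Complex.exp (charFun ν t) := by
    rw [charFun_apply_real]
    refine hsum.unique ?_
    rw [Complex.exp_eq_exp_ℂ]
    exact NormedSpace.expSeries_div_hasSum_exp (charFun ν t)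
  have hval : ∫ x : ℝ, (Complex.exp (Complex.I * t * x) - 1) ∂ν =
      -(ν.real univ : ℂ) + charFun ν t := by
    simp_rw [show ∀ x : ℝ, Complex.I * t * x = t * x * Complex.I from fun x => by ring]
    rw [integral_sub (hint ν) (integrable_const _), ← charFun_apply_real, integral_const]
    simp
    ring
  rw [hval, Complex.exp_add, ← hexp, hCP, charFun_apply_real, charFun_apply_real,
    integral_smul_measure, ENNReal.toReal_ofReal (Real.exp_nonneg _), Complex.real_smul]
  simp

/-! ### Lévy measures on the negative half-line -/

/-- A Lévy measure concentrated on `(-∞, 0)`. -/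
structure IsNegLevyMeasure (Λ : Measure ℝ) : Prop where
  ici_eq_zero : Λ (Ici 0) = 0
  lintegral_lt_top : ∫⁻ x, ENNReal.ofReal (min 1 (x ^ 2)) ∂Λ < ∞

/-- The Laplace exponent `bθ + sθ² + ∫ (e^{θx} - 1 - θx 1_{|x|<1}) Λ(dx)`. -/
noncomputable def lkExp (b s : ℝ) (Λ : Measure ℝ) (θ : ℝ) : ℝ :=
  b * θ + s * θ ^ 2 + ∫ x, (Real.exp (θ * x) - 1 - (if |x| < 1 then θ * x else 0)) ∂Λ

theorem norm_exp_sub_one_sub_le (z : ℂ) :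
    ‖Complex.exp z - 1 - z‖ ≤ ‖z‖ ^ 2 * Real.exp ‖z‖ := by
  have := Complex.norm_exp_sub_sum_le_norm_mul_exp z 2
  simpa [Finset.sum_range_succ, sub_sub] using this

theorem abs_exp_sub_one_sub_le (y : ℝ) :
    |Real.exp y - 1 - y| ≤ y ^ 2 * Real.exp |y| := by
  have := norm_exp_sub_one_sub_le (y : ℂ)
  rw [← Complex.ofReal_exp, ← Complex.ofReal_one, ← Complex.ofReal_sub, ← Complex.ofReal_sub,
    Complex.norm_real, Complex.norm_real] at this
  simpa using this

namespace IsNegLevyMeasure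

variable {Λ : Measure ℝ}

theorem ae_neg (hΛ : IsNegLevyMeasure Λ) : ∀ᵐ x ∂Λ, x < 0 := by
  rw [ae_iff]
  simp only [not_lt]
  exact hΛ.ici_eq_zero

theorem smul (hΛ : IsNegLevyMeasure Λ) (t : ℝ≥0) : IsNegLevyMeasure (t • Λ) := by
  refine ⟨by simp [hΛ.ici_eq_zero], ?_⟩
  rw [lintegral_smul_measure]
  exact ENNReal.mul_lt_top ENNReal.coe_lt_top hΛ.lintegral_lt_top

/-- The point `-1` counts as a large jump because the compensator carries the strict condition `|x|
< 1`. -/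
theorem restrict_eq (hΛ : IsNegLevyMeasure Λ) :
    Λ.restrict (Iic (-1)) + Λ.restrict (Ioo (-1) 0) = Λ := by
  have h1 : (Iic (-1) : Set ℝ) ∪ Ioo (-1) 0 = Iio 0 := by
    ext x; simp only [mem_union, mem_Iic, mem_Ioo, mem_Iio]
    constructor
    · rintro (h | h)
      · linarith
      · exact h.2
    · intro h
      rcases le_or_gt x (-1) with h' | h'
      · exact Or.inl h'
      · exact Or.inr ⟨h', h⟩
  have h2 : Disjoint (Iic (-1) : Set ℝ) (Ioo (-1) 0) := by
    rw [Set.disjoint_left]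
    intro x hx hx'
    exact absurd hx'.1 (not_lt.2 hx)
  rw [← Measure.restrict_union h2 measurableSet_Ioo, h1]
  exact Measure.restrict_eq_self_of_ae_mem hΛ.ae_neg

theorem measure_Iic_lt_top (hΛ : IsNegLevyMeasure Λ) {ε : ℝ} (hε : 0 < ε) :
    Λ (Iic (-ε)) < ∞ := by
  have hε' : 0 < min 1 (ε ^ 2) := by positivity
  refine lt_of_le_of_lt (measure_mono (t := {x | ENNReal.ofReal (min 1 (ε ^ 2)) ≤
    ENNReal.ofReal (min 1 (x ^ 2))}) ?_) ?_
  · intro x hx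
    simp only [Set.mem_ofPred_eq]
    have : ε ^ 2 ≤ x ^ 2 := by
      rw [mem_Iic] at hx
      nlinarith
    gcongr
  · refine lt_of_le_of_lt (meas_ge_le_lintegral_div (by fun_prop) (ENNReal.ofReal_pos.2 hε').ne'
      ENNReal.ofReal_ne_top) ?_
    exact ENNReal.div_lt_top hΛ.lintegral_lt_top.ne (ENNReal.ofReal_pos.2 hε').ne'

theorem isFiniteMeasure_restrict_Iic (hΛ : IsNegLevyMeasure Λ) :
    IsFiniteMeasure (Λ.restrict (Iic (-1))) :=
  ⟨by simpa using hΛ.measure_Iic_lt_top one_pos⟩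

theorem integrableOn_sq (hΛ : IsNegLevyMeasure Λ) : IntegrableOn (fun x => x ^ 2) (Ioo (-1) 0) Λ := by
  refine ⟨by fun_prop, ?_⟩
  rw [hasFiniteIntegral_iff_ofReal (ae_of_all _ fun x => sq_nonneg x)]
  refine lt_of_le_of_lt ?_ hΛ.lintegral_lt_top
  refine le_trans ?_ (setLIntegral_le_lintegral (Ioo (-1) 0) _)
  refine setLIntegral_mono (by fun_prop) fun x hx => ?_
  gcongr
  rw [min_eq_right]
  nlinarith [hx.1, hx.2]

theorem integrableOn_exp_sub_one_sub (hΛ : IsNegLevyMeasure Λ) (θ : ℝ) :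
    IntegrableOn (fun x => Real.exp (θ * x) - 1 - θ * x) (Ioo (-1) 0) Λ := by
  refine Integrable.mono' (hΛ.integrableOn_sq.const_mul (θ ^ 2 * Real.exp |θ|)) (by fun_prop) ?_
  refine (ae_restrict_iff' measurableSet_Ioo).2 (ae_of_all _ fun x hx => ?_)
  refine (abs_exp_sub_one_sub_le _).trans ?_
  have hx1 : |x| ≤ 1 := abs_le.2 ⟨hx.1.le, by linarith [hx.2]⟩
  have h1 : Real.exp |θ * x| ≤ Real.exp |θ| := by
    rw [abs_mul]
    exact Real.exp_le_exp.2 (mul_le_of_le_one_right (abs_nonneg _) hx1)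
  calc (θ * x) ^ 2 * Real.exp |θ * x| ≤ (θ * x) ^ 2 * Real.exp |θ| := by gcongr
    _ = _ := by ring

theorem integrableOn_cexp_sub_one_sub (hΛ : IsNegLevyMeasure Λ) (θ : ℝ) :
    IntegrableOn (fun x : ℝ => Complex.exp (Complex.I * θ * x) - 1 - Complex.I * θ * x)
      (Ioo (-1) 0) Λ := by
  refine Integrable.mono' (hΛ.integrableOn_sq.const_mul (θ ^ 2 * Real.exp |θ|)) (by fun_prop) ?_
  refine (ae_restrict_iff' measurableSet_Ioo).2 (ae_of_all _ fun x hx => ?_)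
  refine (norm_exp_sub_one_sub_le _).trans ?_
  have hx1 : |x| ≤ 1 := abs_le.2 ⟨hx.1.le, by linarith [hx.2]⟩
  have hn : ‖Complex.I * θ * x‖ = |θ * x| := by simp [abs_mul]
  have h1 : Real.exp |θ * x| ≤ Real.exp |θ| := by
    rw [abs_mul]
    exact Real.exp_le_exp.2 (mul_le_of_le_one_right (abs_nonneg _) hx1)
  rw [hn, sq_abs]
  calc (θ * x) ^ 2 * Real.exp |θ * x| ≤ (θ * x) ^ 2 * Real.exp |θ| := by gcongr
    _ = _ := by ring

theorem integrableOn_exp {c : ℝ} (hc : expMoment (Λ.restrict (Iic (-1))) c ≠ ∞) :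
    IntegrableOn (fun x => Real.exp (c * x)) (Iic (-1)) Λ := by
  refine ⟨by fun_prop, ?_⟩
  rw [hasFiniteIntegral_iff_ofReal (ae_of_all _ fun x => Real.exp_nonneg _)]
  exact hc.lt_top

/-- On `(-∞,-1]` the function `e^{θx}` decreases in `θ`, so finiteness propagates to larger
exponents. -/
theorem expMoment_restrict_ne_top {a c : ℝ} (hac : a ≤ c)
    (ha : expMoment (Λ.restrict (Iic (-1))) a ≠ ∞) :
    expMoment (Λ.restrict (Iic (-1))) c ≠ ∞ := by
  refine ne_top_of_le_ne_top ha (setLIntegral_mono (by fun_prop) fun x hx => ?_)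
  rw [mem_Iic] at hx
  exact ENNReal.ofReal_le_ofReal (Real.exp_le_exp.2 (by nlinarith))

theorem expMoment_restrict_zero_ne_top (hΛ : IsNegLevyMeasure Λ) :
    expMoment (Λ.restrict (Iic (-1))) 0 ≠ ∞ := by
  rw [expMoment_zero]
  simpa using (hΛ.measure_Iic_lt_top one_pos).ne

theorem integrableOn_exp_sub_one (hΛ : IsNegLevyMeasure Λ) {c : ℝ}
    (hc : expMoment (Λ.restrict (Iic (-1))) c ≠ ∞) :
    IntegrableOn (fun x => Real.exp (c * x) - 1) (Iic (-1)) Λ := by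
  have := hΛ.isFiniteMeasure_restrict_Iic
  exact (integrableOn_exp hc).sub (integrable_const _)

theorem integral_split {E : Type*} [NormedAddCommGroup E] [NormedSpace ℝ E] (hΛ : IsNegLevyMeasure Λ)
    {f g h : ℝ → E} (hg : IntegrableOn g (Iic (-1)) Λ) (hh : IntegrableOn h (Ioo (-1) 0) Λ)
    (hfg : ∀ x ≤ -1, f x = g x) (hfh : ∀ x, -1 < x → x < 0 → f x = h x) :
    Integrable f Λ ∧
      ∫ x, f x ∂Λ = (∫ x in Iic (-1), g x ∂Λ) + ∫ x in Ioo (-1) 0, h x ∂Λ := by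
  have h1 : IntegrableOn f (Iic (-1)) Λ :=
    hg.congr_fun (fun x hx => (hfg x hx).symm) measurableSet_Iic
  have h2 : IntegrableOn f (Ioo (-1) 0) Λ :=
    hh.congr_fun (fun x hx => (hfh x hx.1 hx.2).symm) measurableSet_Ioo
  refine ⟨by rw [← hΛ.restrict_eq]; exact Integrable.add_measure h1 h2, ?_⟩
  conv_lhs => rw [← hΛ.restrict_eq]
  rw [integral_add_measure h1 h2, setIntegral_congr_fun measurableSet_Iic fun x hx => hfg x hx,
    setIntegral_congr_fun measurableSet_Ioo fun x hx => hfh x hx.1 hx.2]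

theorem lkIntegrand (hΛ : IsNegLevyMeasure Λ) {c : ℝ}
    (hc : expMoment (Λ.restrict (Iic (-1))) c ≠ ∞) :
    Integrable (fun x => Real.exp (c * x) - 1 - (if |x| < 1 then c * x else 0)) Λ ∧
      ∫ x, (Real.exp (c * x) - 1 - (if |x| < 1 then c * x else 0)) ∂Λ =
        (∫ x in Iic (-1), (Real.exp (c * x) - 1) ∂Λ) +
          ∫ x in Ioo (-1) 0, (Real.exp (c * x) - 1 - c * x) ∂Λ := by
  refine hΛ.integral_split (hΛ.integrableOn_exp_sub_one hc) (hΛ.integrableOn_exp_sub_one_sub c)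
    (fun x hx => ?_) (fun x hx hx' => ?_)
  · rw [if_neg (by rw [abs_of_neg (by linarith)]; linarith), sub_zero]
  · rw [if_pos (abs_lt.2 ⟨hx, by linarith⟩)]

theorem integral_cexp_eq (hΛ : IsNegLevyMeasure Λ) (θ : ℝ) :
    ∫ x : ℝ, (Complex.exp (Complex.I * θ * x) - 1 - (if |x| < 1 then Complex.I * θ * x else 0)) ∂Λ =
      (∫ x in Iic (-1), (Complex.exp (Complex.I * θ * (x : ℝ)) - 1) ∂Λ) +
        ∫ x in Ioo (-1) 0, (Complex.exp (Complex.I * θ * (x : ℝ)) - 1 - Complex.I * θ * x) ∂Λ := by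
  have := hΛ.isFiniteMeasure_restrict_Iic
  refine (hΛ.integral_split ?_ (hΛ.integrableOn_cexp_sub_one_sub θ)
    (fun x hx => ?_) (fun x hx hx' => ?_)).2
  · refine Integrable.of_bound (by fun_prop) 2 (ae_of_all _ fun x => ?_)
    refine (norm_sub_le _ _).trans ?_
    rw [mul_assoc, ← Complex.ofReal_mul, mul_comm, Complex.norm_exp_ofReal_mul_I]
    norm_num
  · rw [if_neg (by rw [abs_of_neg (by linarith)]; linarith), sub_zero]
  · rw [if_pos (abs_lt.2 ⟨hx, by linarith⟩)]

end IsNegLevyMeasure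

/-! ### Exponential moments of infinitely divisible laws without positive jumps -/

theorem expMoment_gaussianReal (m : ℝ) (v : ℝ≥0) (c : ℝ) :
    expMoment (gaussianReal m v) c = ENNReal.ofReal (Real.exp (m * c + v * c ^ 2 / 2)) := by
  rw [expMoment, ← ofReal_integral_eq_lintegral_ofReal (integrable_exp_mul_gaussianReal c)
    (ae_of_all _ fun x => Real.exp_nonneg _)]
  congr 1
  exact mgf_gaussianReal (X := id) (p := gaussianReal m v) (by simp) c

theorem iUnion_Ioo_neg_inv : ⋃ n : ℕ, Ioo (-1 : ℝ) (-(1 / (n + 1 : ℝ))) = Ioo (-1) 0 := by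
  ext x
  simp only [mem_iUnion, mem_Ioo]
  constructor
  · rintro ⟨n, h1, h2⟩
    exact ⟨h1, h2.trans (neg_neg_of_pos (by positivity))⟩
  · rintro ⟨h1, h2⟩
    obtain ⟨n, hn⟩ := exists_nat_one_div_lt (neg_pos.2 h2)
    exact ⟨n, h1, by linarith⟩

theorem monotone_Ioo_neg_inv : Monotone fun n : ℕ => Ioo (-1 : ℝ) (-(1 / (n + 1 : ℝ))) := by
  intro m n hmn
  refine Ioo_subset_Ioo_right (neg_le_neg ?_)
  gcongr

namespace IsNegLevyMeasure

variable {Λ : Measure ℝ}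

theorem tendsto_setIntegral_Ioo {E : Type*} [NormedAddCommGroup E] [NormedSpace ℝ E]
    {f : ℝ → E} (hf : IntegrableOn f (Ioo (-1) 0) Λ) :
    Tendsto (fun n : ℕ => ∫ x in Ioo (-1 : ℝ) (-(1 / (n + 1 : ℝ))), f x ∂Λ) atTop
      (𝓝 (∫ x in Ioo (-1) 0, f x ∂Λ)) := by
  have := tendsto_setIntegral_of_monotone (μ := Λ) (f := f) (fun n => measurableSet_Ioo)
    monotone_Ioo_neg_inv (by rwa [iUnion_Ioo_neg_inv])
  rwa [iUnion_Ioo_neg_inv] at this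

theorem isFiniteMeasure_restrict_Ioo (hΛ : IsNegLevyMeasure Λ) (n : ℕ) :
    IsFiniteMeasure (Λ.restrict (Ioo (-1) (-(1 / (n + 1 : ℝ))))) := by
  refine ⟨?_⟩
  rw [Measure.restrict_apply_univ]
  exact (measure_mono fun x hx => hx.2.le).trans_lt (hΛ.measure_Iic_lt_top (by positivity))

theorem integrableOn_Ioo_of_continuous (hΛ : IsNegLevyMeasure Λ) (n : ℕ) {E : Type*}
    [NormedAddCommGroup E] {f : ℝ → E} (hf : Continuous f) :
    IntegrableOn f (Ioo (-1) (-(1 / (n + 1 : ℝ)))) Λ := by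
  have := hΛ.isFiniteMeasure_restrict_Ioo n
  obtain ⟨C, hC⟩ := (isCompact_Icc (a := (-1 : ℝ)) (b := 0)).exists_bound_of_continuousOn
    hf.continuousOn
  have hm : AEStronglyMeasurable f (Λ.restrict (Ioo (-1) (-(1 / (n + 1 : ℝ))))) :=
    hf.aestronglyMeasurable
  refine Integrable.of_bound hm C ((ae_restrict_iff' measurableSet_Ioo).2 (ae_of_all _ fun x hx => ?_))
  exact hC x ⟨hx.1.le, hx.2.le.trans (neg_nonpos.2 (by positivity))⟩

/-- The infinitely divisible law with drift `b`, Gaussian variance `v` and the jumps of `Λ` in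
`(-1, -1/(n+1))`, compensated. -/
noncomputable def smallJumpApprox (b : ℝ) (v : ℝ≥0) (Λ : Measure ℝ) (n : ℕ) : Measure ℝ :=
  gaussianReal (b - ∫ x in Ioo (-1 : ℝ) (-(1 / (n + 1 : ℝ))), x ∂Λ) v ∗
    Measure.compoundPoisson (Λ.restrict (Ioo (-1) (-(1 / (n + 1 : ℝ)))))

/-- The shift of the Gaussian mean supplies the compensator `-cx` of the truncated jumps. -/
theorem expMoment_smallJumpApprox (hΛ : IsNegLevyMeasure Λ) (b : ℝ) (v : ℝ≥0) (n : ℕ) (c : ℝ) :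
    expMoment (smallJumpApprox b v Λ n) c = ENNReal.ofReal (Real.exp (b * c + v * c ^ 2 / 2 +
      ∫ x in Ioo (-1 : ℝ) (-(1 / (n + 1 : ℝ))), (Real.exp (c * x) - 1 - c * x) ∂Λ)) := by
  have := hΛ.isFiniteMeasure_restrict_Ioo n
  have h1 := hΛ.integrableOn_Ioo_of_continuous n (f := fun x => Real.exp (c * x)) (by fun_prop)
  have h2 := hΛ.integrableOn_Ioo_of_continuous n (f := fun x => x) (by fun_prop)
  rw [smallJumpApprox, expMoment_conv, expMoment_gaussianReal,
    expMoment_compoundPoisson (r := ∫ x in Ioo (-1 : ℝ) (-(1 / (n + 1 : ℝ))), Real.exp (c * x) ∂Λ)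
      (integral_nonneg fun x => Real.exp_nonneg _), ← ENNReal.ofReal_mul (Real.exp_nonneg _),
    ← Real.exp_add]
  · congr 2
    have h3 := hΛ.integrableOn_Ioo_of_continuous n (f := fun x => Real.exp (c * x) - 1) (by fun_prop)
    rw [integral_sub h3 (h2.const_mul c),
      integral_sub h1 (integrable_const _), integral_const_mul, integral_const]
    simp only [smul_eq_mul, mul_one]
    ring
  · rw [expMoment, ofReal_integral_eq_lintegral_ofReal h1 (ae_of_all _ fun x => Real.exp_nonneg _)]

theorem charFun_smallJumpApprox (hΛ : IsNegLevyMeasure Λ) (b : ℝ) (v : ℝ≥0) (n : ℕ) (t : ℝ) :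
    charFun (smallJumpApprox b v Λ n) t = Complex.exp (Complex.I * b * t - v * t ^ 2 / 2 +
      ∫ x in Ioo (-1 : ℝ) (-(1 / (n + 1 : ℝ))),
        (Complex.exp (Complex.I * t * x) - 1 - Complex.I * t * x) ∂Λ) := by
  have := hΛ.isFiniteMeasure_restrict_Ioo n
  have h1 := hΛ.integrableOn_Ioo_of_continuous n
    (f := fun x : ℝ => Complex.exp (Complex.I * t * x) - 1) (by fun_prop)
  have h2 := hΛ.integrableOn_Ioo_of_continuous n (f := fun x : ℝ => (x : ℂ)) (by fun_prop)
  rw [smallJumpApprox, charFun_conv, charFun_gaussianReal, charFun_compoundPoisson,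
    ← Complex.exp_add]
  congr 1
  rw [integral_sub h1 (h2.const_mul _), integral_const_mul, integral_complex_ofReal]
  push_cast
  ring

/-- Jumps in `(-1,0)` are square integrable, so for each `c` the moments of the approximations
converge and are bounded in `n`. This yields a weak limit and lets every exponential moment pass to
it. -/
theorem exists_smallJumpLaw (hΛ : IsNegLevyMeasure Λ) (b : ℝ) (v : ℝ≥0) :
    ∃ ρ : Measure ℝ, IsProbabilityMeasure ρ ∧
      (∀ c, expMoment ρ c = ENNReal.ofReal (Real.exp (b * c + v * c ^ 2 / 2 +
        ∫ x in Ioo (-1 : ℝ) 0, (Real.exp (c * x) - 1 - c * x) ∂Λ))) ∧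
      ∀ t : ℝ, charFun ρ t = Complex.exp (Complex.I * b * t - v * t ^ 2 / 2 +
        ∫ x in Ioo (-1 : ℝ) 0, (Complex.exp (Complex.I * t * x) - 1 - Complex.I * t * x) ∂Λ) := by
  have hprob : ∀ n, IsProbabilityMeasure (smallJumpApprox b v Λ n) := fun n => by
    have := hΛ.isFiniteMeasure_restrict_Ioo n
    unfold smallJumpApprox
    infer_instance
  let μ : ℕ → ProbabilityMeasure ℝ := fun n => ⟨smallJumpApprox b v Λ n, hprob n⟩
  have hlim : ∀ c : ℝ, Tendsto (fun n : ℕ => Real.exp (b * c + v * c ^ 2 / 2 +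
      ∫ x in Ioo (-1 : ℝ) (-(1 / (n + 1 : ℝ))), (Real.exp (c * x) - 1 - c * x) ∂Λ)) atTop
      (𝓝 (Real.exp (b * c + v * c ^ 2 / 2 +
        ∫ x in Ioo (-1 : ℝ) 0, (Real.exp (c * x) - 1 - c * x) ∂Λ))) := fun c =>
    (Real.continuous_exp.tendsto _).comp (tendsto_const_nhds.add
      (tendsto_setIntegral_Ioo (hΛ.integrableOn_exp_sub_one_sub c)))
  have hbound : ∀ c, ∃ C : ℝ, ∀ n, expMoment (μ n) c ≤ ENNReal.ofReal C := fun c => by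
    obtain ⟨C, hC⟩ := (hlim c).bddAbove_range
    refine ⟨C, fun n => ?_⟩
    change expMoment (smallJumpApprox b v Λ n) c ≤ _
    rw [hΛ.expMoment_smallJumpApprox]
    exact ENNReal.ofReal_le_ofReal (hC ⟨n, rfl⟩)
  obtain ⟨C₁, hC₁⟩ := hbound 1
  obtain ⟨C₂, hC₂⟩ := hbound (-1)
  obtain ⟨ρ, hρ⟩ := exists_tendsto_of_expMoment_le (μ := μ) one_pos
    (C := ENNReal.ofReal C₁ + ENNReal.ofReal C₂) (by simp) (fun n => (hC₁ n).trans le_self_add)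
    (fun n => (hC₂ n).trans le_add_self)
  refine ⟨ρ, inferInstance, fun c => ?_, fun t => ?_⟩
  · obtain ⟨C, hC⟩ := hbound (2 * c)
    refine expMoment_eq_of_tendsto hρ ENNReal.ofReal_ne_top hC ?_
    refine Tendsto.mono_left ?_ Nat.hyperfilter_le_atTop
    change Tendsto (fun n => expMoment (smallJumpApprox b v Λ n) c) _ _
    simp_rw [hΛ.expMoment_smallJumpApprox]
    exact ENNReal.tendsto_ofReal (hlim c)
  · have h1 : Tendsto (fun n => charFun (μ n : Measure ℝ) t) (hyperfilter ℕ)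
        (𝓝 (charFun (ρ : Measure ℝ) t)) := by
      rw [ProbabilityMeasure.tendsto_iff_forall_integral_rclike_tendsto ℂ] at hρ
      simp_rw [charFun_eq_integral_innerProbChar]
      exact hρ _
    refine tendsto_nhds_unique h1 (Tendsto.mono_left ?_ Nat.hyperfilter_le_atTop)
    change Tendsto (fun n => charFun (smallJumpApprox b v Λ n) t) _ _
    simp_rw [hΛ.charFun_smallJumpApprox]
    exact (Complex.continuous_exp.tendsto _).comp (tendsto_const_nhds.add
      (tendsto_setIntegral_Ioo (hΛ.integrableOn_cexp_sub_one_sub t)))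

/-- The exponential moments of the infinitely divisible law with triple `(b, 2s, Λ)`. -/
theorem expMoment_of_charFun (hΛ : IsNegLevyMeasure Λ) {b s : ℝ} (hs : 0 ≤ s) {π : Measure ℝ}
    [IsProbabilityMeasure π]
    (hπ : ∀ t : ℝ, charFun π t = Complex.exp (Complex.I * b * t - s * t ^ 2 +
      ∫ x : ℝ, (Complex.exp (Complex.I * t * x) - 1 -
        (if |x| < 1 then Complex.I * t * x else 0)) ∂Λ)) (c : ℝ) :
    (expMoment π c ≠ ∞ ↔ expMoment (Λ.restrict (Iic (-1))) c ≠ ∞) ∧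
      (expMoment π c ≠ ∞ → expMoment π c = ENNReal.ofReal (Real.exp (lkExp b s Λ c))) := by
  have hfin := hΛ.isFiniteMeasure_restrict_Iic
  -- A Gaussian of variance `v` contributes `v c²/2`, to be matched with `s c²`.
  obtain ⟨v, hv⟩ : ∃ v : ℝ≥0, (v : ℝ) = 2 * s := ⟨⟨2 * s, by positivity⟩, rfl⟩
  have hv' : ((v : ℝ) : ℂ) = 2 * s := by rw [hv]; push_cast; rfl
  obtain ⟨ρ, hρp, hρE, hρc⟩ := hΛ.exists_smallJumpLaw b v
  have hlaw : π = Measure.compoundPoisson (Λ.restrict (Iic (-1))) ∗ ρ := by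
    refine Measure.ext_of_charFun (funext fun t => ?_)
    rw [hπ, charFun_conv, charFun_compoundPoisson, hρc, ← Complex.exp_add, hΛ.integral_cexp_eq]
    congr 1
    rw [hv']
    ring
  have hE : expMoment π c = expMoment (Measure.compoundPoisson (Λ.restrict (Iic (-1)))) c *
      expMoment ρ c := by rw [hlaw, expMoment_conv]
  -- The small-jump factor is positive, so it cannot cancel an infinite moment of the large jumps.
  have hfin_iff : expMoment π c ≠ ∞ → expMoment (Λ.restrict (Iic (-1))) c ≠ ∞ := by
    intro h htop
    apply h
    have h2 := expMoment_le_compoundPoisson (Λ.restrict (Iic (-1))) c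
    rw [htop, ENNReal.mul_top (by simp [Real.exp_pos]), top_le_iff] at h2
    rw [hE, h2, hρE, ENNReal.top_mul (by simp [Real.exp_pos])]
  have hval : expMoment (Λ.restrict (Iic (-1))) c ≠ ∞ →
      expMoment π c = ENNReal.ofReal (Real.exp (lkExp b s Λ c)) := by
    intro h
    have hint := integrableOn_exp h
    have hr : expMoment (Λ.restrict (Iic (-1))) c =
        ENNReal.ofReal (∫ x in Iic (-1), Real.exp (c * x) ∂Λ) := by
      rw [expMoment, ofReal_integral_eq_lintegral_ofReal hint
        (ae_of_all _ fun x => Real.exp_nonneg _)]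
    rw [hE, hρE, expMoment_compoundPoisson (integral_nonneg fun x => Real.exp_nonneg _) hr,
      ← ENNReal.ofReal_mul (Real.exp_nonneg _), ← Real.exp_add, lkExp, (hΛ.lkIntegrand h).2,
      integral_sub hint (integrable_const _), integral_const]
    congr 2
    simp only [smul_eq_mul, mul_one, hv]
    ring
  exact ⟨⟨hfin_iff, fun h => by rw [hval h]; exact ENNReal.ofReal_ne_top⟩,
    fun h => hval (hfin_iff h)⟩

end IsNegLevyMeasure

/-! ### Exponential tilting of the Laplace exponent -/

namespace IsNegLevyMeasure

variable {Λ : Measure ℝ}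

/-- The weight `e^{ax}` is bounded on `(-1,0)`, so only the large jumps need the hypothesis. -/
theorem tilt (hΛ : IsNegLevyMeasure Λ) {a : ℝ} (ha : expMoment (Λ.restrict (Iic (-1))) a ≠ ∞) :
    IsNegLevyMeasure (Λ.withDensity fun x => ENNReal.ofReal (Real.exp (a * x))) := by
  refine ⟨withDensity_absolutelyContinuous _ _ hΛ.ici_eq_zero, ?_⟩
  rw [lintegral_withDensity_eq_lintegral_mul _ (by fun_prop) (by fun_prop), ← hΛ.restrict_eq,
    lintegral_add_measure]
  refine ENNReal.add_lt_top.2 ⟨?_, ?_⟩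
  · refine lt_of_le_of_lt (lintegral_mono fun x => ?_) ha.lt_top
    rw [Pi.mul_apply]
    exact mul_le_of_le_one_right' (ENNReal.ofReal_le_one.2 (min_le_left _ _))
  · have h : ∫⁻ x in Ioo (-1) 0, ENNReal.ofReal (Real.exp |a|) *
        ENNReal.ofReal (min 1 (x ^ 2)) ∂Λ < ∞ := by
      rw [lintegral_const_mul _ (by fun_prop)]
      exact ENNReal.mul_lt_top ENNReal.ofReal_lt_top
        ((setLIntegral_le_lintegral _ _).trans_lt hΛ.lintegral_lt_top)
    refine lt_of_le_of_lt (setLIntegral_mono (by fun_prop) fun x hx => ?_) h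
    rw [Pi.mul_apply]
    gcongr
    have hx1 : |x| ≤ 1 := abs_le.2 ⟨hx.1.le, by linarith [hx.2]⟩
    calc a * x ≤ |a * x| := le_abs_self _
      _ = |a| * |x| := abs_mul _ _
      _ ≤ |a| := mul_le_of_le_one_right (abs_nonneg _) hx1

/-- The integrand is `O(x²)` near zero. Its integral is the drift correction caused by tilting. -/
theorem integrable_compensator (hΛ : IsNegLevyMeasure Λ) (a : ℝ) :
    Integrable (fun x => if |x| < 1 then x * (Real.exp (a * x) - 1) else 0) Λ := by
  have hint : IntegrableOn (fun x => x * (Real.exp (a * x) - 1)) (Ioo (-1) 0) Λ := by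
    refine Integrable.mono' (hΛ.integrableOn_sq.const_mul (|a| * Real.exp |a|)) (by fun_prop) ?_
    refine (ae_restrict_iff' measurableSet_Ioo).2 (ae_of_all _ fun x hx => ?_)
    have hx1 : |x| ≤ 1 := abs_le.2 ⟨hx.1.le, by linarith [hx.2]⟩
    have h1 : |Real.exp (a * x) - 1| ≤ |a * x| * Real.exp |a * x| := by
      have := Complex.norm_exp_sub_sum_le_norm_mul_exp ((a * x : ℝ) : ℂ) 1
      simp only [Finset.sum_range_one, pow_zero, Nat.factorial_zero, Nat.cast_one, div_one, pow_one,
        Complex.norm_real, Real.norm_eq_abs] at this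
      rwa [← Complex.ofReal_exp, ← Complex.ofReal_one, ← Complex.ofReal_sub,
        Complex.norm_real] at this
    have h2 : Real.exp |a * x| ≤ Real.exp |a| := by
      rw [abs_mul]
      exact Real.exp_le_exp.2 (mul_le_of_le_one_right (abs_nonneg _) hx1)
    rw [Real.norm_eq_abs, abs_mul]
    calc |x| * |Real.exp (a * x) - 1| ≤ |x| * (|a * x| * Real.exp |a|) := by
          gcongr
          exact h1.trans (by gcongr)
      _ = |a| * Real.exp |a| * |x| ^ 2 := by rw [abs_mul]; ring
      _ = _ := by rw [sq_abs]
  refine (hΛ.integral_split (g := fun _ => 0) integrableOn_zero hint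
    (fun x hx => ?_) (fun x hx hx' => ?_)).1
  · rw [if_neg (by rw [abs_of_neg (by linarith)]; linarith)]
  · rw [if_pos (abs_lt.2 ⟨hx, by linarith⟩)]

/-- The Esscher transform: `e^{ax}` weights the jumps, the Gaussian part is unchanged, and
completing the square and recompensating the small jumps change the drift. -/
theorem lkExp_tilt (hΛ : IsNegLevyMeasure Λ) (b s : ℝ) {a θ : ℝ}
    (ha : expMoment (Λ.restrict (Iic (-1))) a ≠ ∞)
    (haθ : expMoment (Λ.restrict (Iic (-1))) (a + θ) ≠ ∞) :
    lkExp b s Λ (a + θ) - lkExp b s Λ a =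
      lkExp (b + 2 * s * a + ∫ x, (if |x| < 1 then x * (Real.exp (a * x) - 1) else 0) ∂Λ) s
        (Λ.withDensity fun x => ENNReal.ofReal (Real.exp (a * x))) θ := by
  have h1 := (hΛ.lkIntegrand haθ).1
  have h2 := (hΛ.lkIntegrand ha).1
  have h3 := hΛ.integrable_compensator a
  have h12 : Integrable (fun x => Real.exp ((a + θ) * x) - 1 -
      (if |x| < 1 then (a + θ) * x else 0) -
      (Real.exp (a * x) - 1 - (if |x| < 1 then a * x else 0))) Λ := h1.sub h2
  have key : ∫ x, (Real.exp (θ * x) - 1 - (if |x| < 1 then θ * x else 0))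
      ∂(Λ.withDensity fun x => ENNReal.ofReal (Real.exp (a * x))) =
      (∫ x, (Real.exp ((a + θ) * x) - 1 - (if |x| < 1 then (a + θ) * x else 0)) ∂Λ) -
      (∫ x, (Real.exp (a * x) - 1 - (if |x| < 1 then a * x else 0)) ∂Λ) -
      θ * ∫ x, (if |x| < 1 then x * (Real.exp (a * x) - 1) else 0) ∂Λ := by
    rw [integral_withDensity_eq_integral_toReal_smul (by fun_prop) (ae_of_all _ fun x => by simp),
      ← integral_const_mul, ← integral_sub h1 h2, ← integral_sub h12 (h3.const_mul θ)]
    refine integral_congr_ae (ae_of_all _ fun x => ?_)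
    simp only [ENNReal.toReal_ofReal (Real.exp_nonneg _), smul_eq_mul, add_mul, Real.exp_add]
    split_ifs <;> ring
  rw [lkExp, lkExp, lkExp, key]
  ring

theorem abs_lkIntegrand_le {θ T x : ℝ} (hθ : 0 ≤ θ) (hT : θ ≤ T) (hx : x < 0) :
    |Real.exp (θ * x) - 1 - (if |x| < 1 then θ * x else 0)| ≤
      (1 + T ^ 2 * Real.exp T) * min 1 (x ^ 2) := by
  have hT0 : 0 ≤ T := hθ.trans hT
  split_ifs with h
  · have hsq : x ^ 2 ≤ 1 := by rw [← sq_abs]; nlinarith [abs_nonneg x]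
    rw [min_eq_right hsq]
    refine (abs_exp_sub_one_sub_le _).trans ?_
    have h1 : |θ * x| ≤ T := by
      rw [abs_mul, abs_of_nonneg hθ]
      nlinarith [abs_nonneg x]
    calc (θ * x) ^ 2 * Real.exp |θ * x| = (θ ^ 2 * Real.exp |θ * x|) * x ^ 2 := by ring
      _ ≤ (T ^ 2 * Real.exp T) * x ^ 2 := by gcongr
      _ ≤ _ := by gcongr; linarith
  · have hsq : 1 ≤ x ^ 2 := by rw [← sq_abs]; nlinarith [abs_nonneg x]
    rw [min_eq_left hsq, sub_zero, mul_one]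
    have h1 : Real.exp (θ * x) ≤ 1 := Real.exp_le_one_iff.2 (by nlinarith)
    have h2 := Real.exp_pos (θ * x)
    have h3 : 0 ≤ T ^ 2 * Real.exp T := by positivity
    rw [abs_le]
    constructor <;> linarith

theorem integrable_min_one_sq (hΛ : IsNegLevyMeasure Λ) : Integrable (fun x => min 1 (x ^ 2)) Λ := by
  refine ⟨by fun_prop, ?_⟩
  rw [hasFiniteIntegral_iff_ofReal (ae_of_all _ fun x => by positivity)]
  exact hΛ.lintegral_lt_top

theorem continuousOn_lkExp (hΛ : IsNegLevyMeasure Λ) (b s : ℝ) :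
    ContinuousOn (lkExp b s Λ) (Ici 0) := by
  intro θ₀ hθ₀
  refine ContinuousWithinAt.add (by fun_prop) ?_
  refine continuousWithinAt_of_dominated
    (bound := fun x => (1 + (θ₀ + 1) ^ 2 * Real.exp (θ₀ + 1)) * min 1 (x ^ 2)) ?_ ?_
    (hΛ.integrable_min_one_sq.const_mul _) ?_
  · refine Eventually.of_forall fun θ => Measurable.aestronglyMeasurable ?_
    exact (by fun_prop : Measurable fun x => Real.exp (θ * x) - 1).sub
      (Measurable.ite (measurableSet_lt (by fun_prop) measurable_const) (by fun_prop) (by fun_prop))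
  · have h1 : ∀ᶠ θ in 𝓝[Ici 0] θ₀, θ ≤ θ₀ + 1 :=
      mem_nhdsWithin_of_mem_nhds (Iic_mem_nhds (by linarith))
    filter_upwards [h1, self_mem_nhdsWithin] with θ hθ hθ'
    filter_upwards [hΛ.ae_neg] with x hx
    exact abs_lkIntegrand_le hθ' hθ hx
  · refine ae_of_all _ fun x => ?_
    split_ifs <;> fun_prop

theorem lkExp_zero (b s : ℝ) (Λ : Measure ℝ) : lkExp b s Λ 0 = 0 := by
  simp [lkExp]

/-! ### The compensated form of a positive Laplace exponent -/

theorem tendsto_exp_slope (x : ℝ) :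
    Tendsto (fun t : ℝ => (Real.exp (t * x) - 1) / t) (𝓝[>] 0) (𝓝 x) := by
  have h : HasDerivAt (fun t : ℝ => Real.exp (t * x)) x 0 := by
    have := ((hasDerivAt_id (0 : ℝ)).mul_const x).exp
    simpa using this
  have := h.tendsto_slope_zero_right
  refine this.congr fun t => ?_
  simp [div_eq_inv_mul]

theorem tendsto_one_div_succ : Tendsto (fun n : ℕ => 1 / ((n : ℝ) + 1)) atTop (𝓝[>] 0) :=
  tendsto_nhdsWithin_iff.2 ⟨tendsto_one_div_add_atTop_nhds_zero_nat,
    Eventually.of_forall fun n => by simp only [mem_Ioi]; positivity⟩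

/-- Positivity of the exponent excludes infinite negative mean. For `0 < θ ≤ 1`, dividing `lkExp b s
Λ θ > 0` by `θ` bounds `∫_{x ≤ -1} (1 - e^{θx})/θ` by a constant, and Fatou's lemma applies as `θ →
0`. -/
theorem integrableOn_id (hΛ : IsNegLevyMeasure Λ) {b s : ℝ} (hs : 0 ≤ s)
    (hpos : ∀ θ, 0 < θ → 0 < lkExp b s Λ θ) : IntegrableOn (fun x => x) (Iic (-1)) Λ := by
  have hsq := hΛ.integrableOn_sq
  set C : ℝ := b + s + Real.exp 1 * ∫ x in Ioo (-1) 0, x ^ 2 ∂Λ with hC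
  have hbound : ∀ θ : ℝ, 0 < θ → θ ≤ 1 →
      ∫⁻ x in Iic (-1), ENNReal.ofReal (-((Real.exp (θ * x) - 1) / θ)) ∂Λ ≤ ENNReal.ofReal C := by
    intro θ hθ hθ1
    have hfin := hΛ.expMoment_restrict_zero_ne_top
    have hfinθ := expMoment_restrict_ne_top hθ.le hfin
    have hI1 := hΛ.integrableOn_exp_sub_one hfinθ
    have hI2 := hΛ.integrableOn_exp_sub_one_sub θ
    have hI3 : IntegrableOn (fun x => -((Real.exp (θ * x) - 1) / θ)) (Iic (-1)) Λ :=
      (hI1.div_const θ).neg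
    rw [← ofReal_integral_eq_lintegral_ofReal hI3]
    · refine ENNReal.ofReal_le_ofReal ?_
      have h1 := hpos θ hθ
      rw [lkExp, (hΛ.lkIntegrand hfinθ).2] at h1
      have h2 : ∫ x in Ioo (-1) 0, (Real.exp (θ * x) - 1 - θ * x) ∂Λ ≤
          ∫ x in Ioo (-1) 0, (θ ^ 2 * Real.exp 1) * x ^ 2 ∂Λ := by
        refine setIntegral_mono_on hI2 (hsq.const_mul _) measurableSet_Ioo fun x hx => ?_
        refine (le_abs_self _).trans ((abs_exp_sub_one_sub_le _).trans ?_)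
        have hx1 : |x| ≤ 1 := abs_le.2 ⟨hx.1.le, by linarith [hx.2]⟩
        have h3 : |θ * x| ≤ 1 := by
          rw [abs_mul, abs_of_pos hθ]
          nlinarith [abs_nonneg x]
        calc (θ * x) ^ 2 * Real.exp |θ * x| ≤ (θ * x) ^ 2 * Real.exp 1 := by gcongr
          _ = _ := by ring
      rw [integral_const_mul] at h2
      have h4 : ∫ x in Iic (-1), -((Real.exp (θ * x) - 1) / θ) ∂Λ =
          -((∫ x in Iic (-1), (Real.exp (θ * x) - 1) ∂Λ) / θ) := by
        rw [integral_neg, integral_div]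
      have hθ2 : θ ^ 2 ≤ θ := by nlinarith
      have hJ : 0 ≤ ∫ x in Ioo (-1) 0, x ^ 2 ∂Λ := integral_nonneg fun x => sq_nonneg x
      rw [h4, neg_le, le_div_iff₀ hθ, hC]
      have h5 : θ ^ 2 * Real.exp 1 * ∫ x in Ioo (-1) 0, x ^ 2 ∂Λ ≤
          θ * (Real.exp 1 * ∫ x in Ioo (-1) 0, x ^ 2 ∂Λ) := by
        have h0 : 0 ≤ Real.exp 1 * ∫ x in Ioo (-1) 0, x ^ 2 ∂Λ := by positivity
        rw [mul_assoc]
        exact mul_le_mul_of_nonneg_right hθ2 h0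
      have h6 := mul_le_mul_of_nonneg_left hθ2 hs
      linarith
    · refine (ae_restrict_iff' measurableSet_Iic).2 (ae_of_all _ fun x hx => ?_)
      simp only [Pi.zero_apply, mem_Iic] at hx ⊢
      have : Real.exp (θ * x) ≤ 1 := Real.exp_le_one_iff.2 (by nlinarith)
      rw [neg_nonneg]
      exact div_nonpos_of_nonpos_of_nonneg (by linarith) hθ.le
  have hlt : ∫⁻ x in Iic (-1), ENNReal.ofReal (-x) ∂Λ ≤ ENNReal.ofReal C := by
    have hlim : ∀ x : ℝ, Tendsto (fun n : ℕ => ENNReal.ofReal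
        (-((Real.exp (1 / ((n : ℝ) + 1) * x) - 1) / (1 / ((n : ℝ) + 1))))) atTop
        (𝓝 (ENNReal.ofReal (-x))) := fun x =>
      ENNReal.tendsto_ofReal (((tendsto_exp_slope x).comp tendsto_one_div_succ).neg)
    have h1 : ∫⁻ x in Iic (-1), ENNReal.ofReal (-x) ∂Λ =
        ∫⁻ x in Iic (-1), liminf (fun n : ℕ => ENNReal.ofReal
          (-((Real.exp (1 / ((n : ℝ) + 1) * x) - 1) / (1 / ((n : ℝ) + 1))))) atTop ∂Λ := by
      congr with x
      exact (hlim x).liminf_eq.symm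
    rw [h1]
    refine (lintegral_liminf_le fun n => by fun_prop).trans ?_
    refine liminf_le_of_le ⟨0, by simp⟩ fun y hy => ?_
    obtain ⟨n, hn⟩ := hy.exists
    refine hn.trans (hbound _ (by positivity) ?_)
    rw [div_le_one (by positivity)]
    linarith [(Nat.cast_nonneg n : (0 : ℝ) ≤ n)]
  have hneg : IntegrableOn (fun x => -x) (Iic (-1)) Λ := by
    refine ⟨by fun_prop, ?_⟩
    rw [hasFiniteIntegral_iff_ofReal ((ae_restrict_iff' measurableSet_Iic).2
      (ae_of_all _ fun x hx => ?_))]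
    · exact hlt.trans_lt ENNReal.ofReal_lt_top
    · simp only [Pi.zero_apply, mem_Iic] at hx ⊢; linarith
  exact hneg.neg.congr (ae_of_all _ fun x => neg_neg x)

end IsNegLevyMeasure

/-! ### The potential measure with Laplace transform `θ / ψ(θ)` -/

/-- The measure on `(0, ∞)` with density `z ↦ M(-∞, -z)`. -/
noncomputable def Measure.tail (M : Measure ℝ) : Measure ℝ :=
  (volume.restrict (Ioi 0)).withDensity fun z => M (Iio (-z))

theorem ae_nonneg_tail (M : Measure ℝ) : ∀ᵐ z ∂(Measure.tail M), 0 ≤ z :=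
  ae_withDensity_of_ae ((ae_restrict_iff' measurableSet_Ioi).2 (ae_of_all _ fun _ hz => le_of_lt hz)) _

theorem setLIntegral_exp_Ioo {θ y : ℝ} (hθ : 0 < θ) (hy : 0 ≤ y) :
    ∫⁻ z in Ioo 0 y, ENNReal.ofReal (Real.exp (-θ * z)) =
      ENNReal.ofReal ((1 - Real.exp (-θ * y)) / θ) := by
  have hint : IntegrableOn (fun z => Real.exp (-θ * z)) (Ioo 0 y) :=
    (Continuous.integrableOn_Icc (by fun_prop)).mono_set Ioo_subset_Icc_self
  rw [← ofReal_integral_eq_lintegral_ofReal hint (ae_of_all _ fun x => Real.exp_nonneg _),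
    ← integral_Ioc_eq_integral_Ioo, ← intervalIntegral.integral_of_le hy]
  congr 1
  rw [intervalIntegral.integral_comp_mul_left _ (neg_ne_zero.2 hθ.ne'), integral_exp]
  simp only [mul_zero, Real.exp_zero, smul_eq_mul]
  field_simp
  ring

/-- Tonelli, with `∫_0^{-x} e^{-θz} dz = (1 - e^{θx})/θ` for `x < 0`. -/
theorem expMoment_tail {M : Measure ℝ} [SFinite M] (hM : ∀ᵐ x ∂M, x < 0) {θ : ℝ} (hθ : 0 < θ) :
    expMoment (Measure.tail M) (-θ) =
      ∫⁻ x, ENNReal.ofReal ((1 - Real.exp (θ * x)) / θ) ∂M := by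
  have hanti : Antitone fun z => M (Iio (-z)) := fun a b hab =>
    measure_mono (Iio_subset_Iio (neg_le_neg hab))
  rw [expMoment, Measure.tail,
    lintegral_withDensity_eq_lintegral_mul _ hanti.measurable (by fun_prop)]
  have hS : MeasurableSet {p : ℝ × ℝ | p.2 < -p.1} :=
    measurableSet_lt measurable_snd measurable_fst.neg
  have h1 : ∀ z : ℝ, ((fun z => M (Iio (-z))) * fun z => ENNReal.ofReal (Real.exp (-θ * z))) z =
      ∫⁻ x, {p : ℝ × ℝ | p.2 < -p.1}.indicator
        (fun p => ENNReal.ofReal (Real.exp (-θ * p.1))) (z, x) ∂M := fun z => by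
    rw [Pi.mul_apply, mul_comm, ← setLIntegral_const, ← lintegral_indicator measurableSet_Iio]
    rfl
  simp_rw [h1]
  rw [lintegral_lintegral_swap]
  · refine lintegral_congr_ae ?_
    filter_upwards [hM] with x hx
    have h2 : ∀ z : ℝ, {p : ℝ × ℝ | p.2 < -p.1}.indicator
        (fun p => ENNReal.ofReal (Real.exp (-θ * p.1))) (z, x) =
        (Iio (-x)).indicator (fun z => ENNReal.ofReal (Real.exp (-θ * z))) z := fun z => by
      simp only [indicator_apply, Set.mem_ofPred_eq, mem_Iio, lt_neg]
    simp_rw [h2]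
    rw [lintegral_indicator measurableSet_Iio, Measure.restrict_restrict measurableSet_Iio,
      inter_comm, Ioi_inter_Iio, setLIntegral_exp_Ioo hθ (by linarith)]
    simp
  · exact (Measurable.indicator (by fun_prop) hS).aemeasurable

namespace IsNegLevyMeasure

variable {Λ : Measure ℝ}

/-- Once `x` is integrable over the large jumps, every jump can be compensated; the drift then
becomes the slope of the exponent at `0+`. -/
theorem lkExp_eq_compensated (hΛ : IsNegLevyMeasure Λ) (hid : IntegrableOn (fun x => x) (Iic (-1)) Λ)
    (b s : ℝ) {θ : ℝ} (hθ : 0 ≤ θ) :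
    Integrable (fun x => Real.exp (θ * x) - 1 - θ * x) Λ ∧
      lkExp b s Λ θ = (b + ∫ x in Iic (-1), x ∂Λ) * θ + s * θ ^ 2 +
        ∫ x, (Real.exp (θ * x) - 1 - θ * x) ∂Λ := by
  have hfin := expMoment_restrict_ne_top hθ hΛ.expMoment_restrict_zero_ne_top
  have h1 := hΛ.integrableOn_exp_sub_one hfin
  obtain ⟨hi, he⟩ := hΛ.integral_split (f := fun x => Real.exp (θ * x) - 1 - θ * x)
    (g := fun x => Real.exp (θ * x) - 1 - θ * x) (h := fun x => Real.exp (θ * x) - 1 - θ * x)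
    (h1.sub (hid.const_mul θ)) (hΛ.integrableOn_exp_sub_one_sub θ) (fun _ _ => rfl)
    (fun _ _ _ => rfl)
  refine ⟨hi, ?_⟩
  rw [he, lkExp, (hΛ.lkIntegrand hfin).2, integral_sub h1 (hid.const_mul θ), integral_const_mul]
  ring

theorem abs_compensated_le {θ x : ℝ} (hθ : 0 < θ) (hθ1 : θ ≤ 1) (hx : x < 0) :
    |(Real.exp (θ * x) - 1 - θ * x) / θ| ≤ if |x| < 1 then Real.exp 1 * x ^ 2 else -x := by
  rw [abs_div, abs_of_pos hθ, div_le_iff₀ hθ]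
  split_ifs with h
  · have h3 : |θ * x| ≤ 1 := by
      rw [abs_mul, abs_of_pos hθ]
      nlinarith [abs_nonneg x]
    have hθ2 : θ ^ 2 ≤ θ := by nlinarith
    calc _ ≤ (θ * x) ^ 2 * Real.exp |θ * x| := abs_exp_sub_one_sub_le _
      _ ≤ (θ * x) ^ 2 * Real.exp 1 := by gcongr
      _ = θ ^ 2 * (x ^ 2 * Real.exp 1) := by ring
      _ ≤ θ * (x ^ 2 * Real.exp 1) := by gcongr
      _ = _ := by ring
  · have h1 : Real.exp (θ * x) ≤ 1 := Real.exp_le_one_iff.2 (by nlinarith)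
    have h2 := Real.add_one_le_exp (θ * x)
    rw [abs_of_nonneg (by linarith)]
    linarith

/-- The drift is the limit of `lkExp b s Λ θ / θ > 0` as `θ → 0+`, by dominated convergence. -/
theorem drift_nonneg (hΛ : IsNegLevyMeasure Λ) {b s : ℝ} (hs : 0 ≤ s)
    (hpos : ∀ θ, 0 < θ → 0 < lkExp b s Λ θ) : 0 ≤ b + ∫ x in Iic (-1), x ∂Λ := by
  have hid := hΛ.integrableOn_id hs hpos
  set p := b + ∫ x in Iic (-1), x ∂Λ with hp
  have hdom : Integrable (fun x => if |x| < 1 then Real.exp 1 * x ^ 2 else -x) Λ := by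
    refine (hΛ.integral_split (g := fun x => -x) (h := fun x => Real.exp 1 * x ^ 2) hid.neg
      (hΛ.integrableOn_sq.const_mul _) (fun x hx => ?_) (fun x hx hx' => ?_)).1
    · rw [if_neg (by rw [abs_of_neg (by linarith)]; linarith)]
    · rw [if_pos (abs_lt.2 ⟨hx, by linarith⟩)]
  have hθ : ∀ n : ℕ, 0 < 1 / ((n : ℝ) + 1) := fun n => by positivity
  have hθ1 : ∀ n : ℕ, 1 / ((n : ℝ) + 1) ≤ 1 := fun n => by
    rw [div_le_one (by positivity)]
    linarith [(Nat.cast_nonneg n : (0 : ℝ) ≤ n)]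
  have hK : Tendsto (fun n : ℕ => ∫ x, (Real.exp (1 / ((n : ℝ) + 1) * x) - 1 -
      1 / ((n : ℝ) + 1) * x) / (1 / ((n : ℝ) + 1)) ∂Λ) atTop (𝓝 (∫ x, (0 : ℝ) ∂Λ)) := by
    refine tendsto_integral_of_dominated_convergence _ (fun n => by fun_prop) hdom
      (fun n => ?_) (ae_of_all _ fun x => ?_)
    · filter_upwards [hΛ.ae_neg] with x hx
      exact abs_compensated_le (hθ n) (hθ1 n) hx
    · have := ((tendsto_exp_slope x).comp tendsto_one_div_succ).sub_const x
      rw [sub_self] at this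
      refine this.congr fun n => ?_
      have := (hθ n).ne'
      simp only [Function.comp_apply]
      field_simp
  rw [integral_zero] at hK
  have hlim : Tendsto (fun n : ℕ => p + s * (1 / ((n : ℝ) + 1)) +
      ∫ x, (Real.exp (1 / ((n : ℝ) + 1) * x) - 1 -
      1 / ((n : ℝ) + 1) * x) / (1 / ((n : ℝ) + 1)) ∂Λ) atTop (𝓝 (p + s * 0 + 0)) :=
    (tendsto_const_nhds.add (tendsto_const_nhds.mul tendsto_one_div_add_atTop_nhds_zero_nat)).add hK
  rw [mul_zero, add_zero, add_zero] at hlim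
  refine ge_of_tendsto' hlim fun n => ?_
  have h1 := hpos _ (hθ n)
  rw [(hΛ.lkExp_eq_compensated hid b s (hθ n).le).2, ← hp] at h1
  rw [integral_div, ← mul_le_mul_iff_left₀ (hθ n), zero_mul, add_mul,
    div_mul_cancel₀ _ (hθ n).ne']
  nlinarith

theorem integrableOn_Iio_neg_inv (hΛ : IsNegLevyMeasure Λ)
    (hid : IntegrableOn (fun x => x) (Iic (-1)) Λ) (n : ℕ) :
    IntegrableOn (fun x => x) (Iio (-(1 / (n + 1 : ℝ)))) Λ := by
  have h : Iio (-(1 / (n + 1 : ℝ))) ⊆ Iic (-1) ∪ Ioo (-1) (-(1 / (n + 1 : ℝ))) := fun x hx => by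
    rcases le_or_gt x (-1) with h | h
    · exact Or.inl h
    · exact Or.inr ⟨h, hx⟩
  exact (hid.union (hΛ.integrableOn_Ioo_of_continuous n continuous_id)).mono_set h

theorem isFiniteMeasure_restrict_Iio (hΛ : IsNegLevyMeasure Λ) (n : ℕ) :
    IsFiniteMeasure (Λ.restrict (Iio (-(1 / (n + 1 : ℝ))))) := by
  refine ⟨?_⟩
  rw [Measure.restrict_apply_univ]
  exact (measure_mono Iio_subset_Iic_self).trans_lt (hΛ.measure_Iic_lt_top (by positivity))

theorem compensated_nonneg (y : ℝ) : 0 ≤ Real.exp y - 1 - y := by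
  linarith [Real.add_one_le_exp y]

/-- If `ψ` is positive on `(0, ∞)`, then `θ / ψ(θ)` is the Laplace transform of a measure. -/
theorem exists_potential (hΛ : IsNegLevyMeasure Λ) {b s : ℝ} (hs : 0 ≤ s)
    (hpos : ∀ θ, 0 < θ → 0 < lkExp b s Λ θ) :
    ∃ U : Measure ℝ, SFinite U ∧ (∀ᵐ x ∂U, 0 ≤ x) ∧
      ∀ θ, 0 < θ → expMoment U (-θ) = ENNReal.ofReal (θ / lkExp b s Λ θ) := by
  have hid := hΛ.integrableOn_id hs hpos
  have hp := hΛ.drift_nonneg hs hpos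
  set p := b + ∫ x in Iic (-1), x ∂Λ with hpdef
  -- The function `κ n` approximates `κ(θ) = lkExp b s Λ θ / θ`. The term `sθ` becomes `s r (1 -
  -- e^{-θ/r})`, jumps above `-1/r` are dropped, and `1/r` is added to keep the constant positive.
  let r : ℕ → ℝ := fun n => (n : ℝ) + 1
  have hr : ∀ n, 0 < r n := fun n => by positivity
  let Z : ℕ → Set ℝ := fun n => Iio (-(1 / (n + 1 : ℝ)))
  let κ : ℕ → ℝ → ℝ := fun n θ => p + 1 / r n + s * r n * (1 - Real.exp (-θ * (1 / r n))) +
    (∫ x in Z n, (Real.exp (θ * x) - 1 - θ * x) ∂Λ) / θ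
  have hκ : ∀ n θ, 0 < θ → 0 < κ n θ := fun n θ hθ => by
    have h1 : Real.exp (-θ * (1 / r n)) ≤ 1 := by
      have : 0 < θ * (1 / r n) := mul_pos hθ (one_div_pos.2 (hr n))
      exact Real.exp_le_one_iff.2 (by linarith)
    have h2 : 0 ≤ (∫ x in Z n, (Real.exp (θ * x) - 1 - θ * x) ∂Λ) / θ :=
      div_nonneg (integral_nonneg fun x => compensated_nonneg _) hθ.le
    have h3 : 0 ≤ s * r n * (1 - Real.exp (-θ * (1 / r n))) :=
      mul_nonneg (mul_nonneg hs (hr n).le) (by linarith)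
    have h4 : 0 < 1 / r n := one_div_pos.2 (hr n)
    change 0 < p + 1 / r n + s * r n * (1 - Real.exp (-θ * (1 / r n))) +
      (∫ x in Z n, (Real.exp (θ * x) - 1 - θ * x) ∂Λ) / θ
    linarith
  let ν : ℕ → Measure ℝ := fun n => ENNReal.ofReal (s * r n) • Measure.dirac (1 / r n) +
    Measure.tail (Λ.restrict (Z n))
  have hνsf : ∀ n, SFinite (ν n) := fun n => by
    change SFinite (_ + Measure.tail (Λ.restrict (Z n)))
    unfold Measure.tail
    infer_instance
  have hνnn : ∀ n, ∀ᵐ x ∂(ν n), 0 ≤ x := fun n => by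
    rw [ae_add_measure_iff]
    refine ⟨Measure.ae_smul_measure ?_ _, ae_nonneg_tail _⟩
    rw [ae_dirac_iff (measurableSet_Ici)]
    exact (one_div_pos.2 (hr n)).le
  -- Since `(e^{θx} - 1 - θx)/θ = -x - (1 - e^{θx})/θ`, the constants of `κ n` collect into `a n`
  -- and the rest is minus the transform of `ν n`. Thus `1/κ n` is the transform of a resolvent.
  let a : ℕ → ℝ := fun n => p + 1 / r n + s * r n + ∫ x in Z n, -x ∂Λ
  have hZneg : ∀ n, ∀ x ∈ Z n, x < 0 := fun n x hx =>
    (mem_Iio.1 hx).trans (neg_neg_of_pos (by positivity))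
  have hνE : ∀ n θ, 0 < θ → expMoment (ν n) (-θ) = ENNReal.ofReal
      (s * r n * Real.exp (-θ * (1 / r n)) + ∫ x in Z n, (1 - Real.exp (θ * x)) / θ ∂Λ) := by
    intro n θ hθ
    have := hΛ.isFiniteMeasure_restrict_Iio n
    have hneg : ∀ᵐ x ∂(Λ.restrict (Z n)), x < 0 :=
      (ae_restrict_iff' measurableSet_Iio).2 (ae_of_all _ (hZneg n))
    have hnn : ∀ᵐ x ∂(Λ.restrict (Z n)), 0 ≤ (1 - Real.exp (θ * x)) / θ := by
      filter_upwards [hneg] with x hx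
      have : Real.exp (θ * x) ≤ 1 := Real.exp_le_one_iff.2 (by nlinarith)
      exact div_nonneg (by linarith) hθ.le
    have hint : Integrable (fun x => (1 - Real.exp (θ * x)) / θ) (Λ.restrict (Z n)) := by
      refine Integrable.of_bound (by fun_prop) (1 / θ) ?_
      filter_upwards [hnn] with x hx
      rw [Real.norm_of_nonneg hx]
      gcongr
      linarith [Real.exp_pos (θ * x)]
    rw [expMoment_add, expMoment_smul, expMoment_dirac, expMoment_tail hneg hθ,
      ← ENNReal.ofReal_mul (mul_nonneg hs (hr n).le), ← ofReal_integral_eq_lintegral_ofReal hint hnn,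
      ← ENNReal.ofReal_add (mul_nonneg (mul_nonneg hs (hr n).le) (Real.exp_nonneg _))
        (integral_nonneg_of_ae hnn)]
  have haκ : ∀ n θ, 0 < θ → a n - (s * r n * Real.exp (-θ * (1 / r n)) +
      ∫ x in Z n, (1 - Real.exp (θ * x)) / θ ∂Λ) = κ n θ := by
    intro n θ hθ
    have := hΛ.isFiniteMeasure_restrict_Iio n
    have h1 : Integrable (fun x => -x) (Λ.restrict (Z n)) := (hΛ.integrableOn_Iio_neg_inv hid n).neg
    have h2 : Integrable (fun x => (1 - Real.exp (θ * x)) / θ) (Λ.restrict (Z n)) := by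
      refine Integrable.div_const ((integrable_const _).sub ?_) _
      refine Integrable.of_bound (by fun_prop) 1
        ((ae_restrict_iff' measurableSet_Iio).2 (ae_of_all _ fun x hx => ?_))
      have := hZneg n x hx
      rw [Real.norm_of_nonneg (Real.exp_nonneg _)]
      exact Real.exp_le_one_iff.2 (by nlinarith)
    have h3 : (∫ x in Z n, (Real.exp (θ * x) - 1 - θ * x) ∂Λ) / θ =
        (∫ x in Z n, -x ∂Λ) - ∫ x in Z n, (1 - Real.exp (θ * x)) / θ ∂Λ := by
      rw [← integral_sub h1 h2, ← integral_div]
      refine integral_congr_ae (ae_of_all _ fun x => ?_)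
      change _ / θ = -x - (1 - Real.exp (θ * x)) / θ
      field_simp
      ring
    change p + 1 / r n + s * r n + (∫ x in Z n, -x ∂Λ) - _ = p + 1 / r n +
      s * r n * (1 - Real.exp (-θ * (1 / r n))) + _
    rw [h3]
    ring
  have ha : ∀ n, 0 < a n := fun n => by
    have h1 : 0 ≤ ∫ x in Z n, -x ∂Λ :=
      setIntegral_nonneg measurableSet_Iio fun x hx => by linarith [hZneg n x hx]
    have h2 := one_div_pos.2 (hr n)
    have h3 := mul_nonneg hs (hr n).le
    change 0 < p + 1 / r n + s * r n + ∫ x in Z n, -x ∂Λ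
    linarith
  have hUnion : ⋃ n, Z n = Iio 0 := by
    ext x
    simp only [mem_iUnion, mem_Iio, Z]
    constructor
    · rintro ⟨n, h⟩
      exact h.trans (neg_neg_of_pos (by positivity))
    · intro h
      obtain ⟨n, hn⟩ := exists_nat_one_div_lt (neg_pos.2 h)
      exact ⟨n, by linarith⟩
  have hlim : ∀ θ, 0 < θ → Tendsto (fun n => κ n θ) atTop (𝓝 (lkExp b s Λ θ / θ)) := by
    intro θ hθ
    obtain ⟨hint, heq⟩ := hΛ.lkExp_eq_compensated hid b s hθ.le
    have h1 : Tendsto (fun n => ∫ x in Z n, (Real.exp (θ * x) - 1 - θ * x) ∂Λ) atTop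
        (𝓝 (∫ x, (Real.exp (θ * x) - 1 - θ * x) ∂Λ)) := by
      have := tendsto_setIntegral_of_monotone (μ := Λ) (s := Z)
        (f := fun x => Real.exp (θ * x) - 1 - θ * x) (fun n => measurableSet_Iio)
        (fun m n hmn => Iio_subset_Iio (neg_le_neg (by gcongr))) hint.integrableOn
      rwa [hUnion, Measure.restrict_eq_self_of_ae_mem (s := Iio 0) hΛ.ae_neg] at this
    have h2 : Tendsto (fun n => s * r n * (1 - Real.exp (-θ * (1 / r n)))) atTop
        (𝓝 (s * θ)) := by
      have := ((tendsto_exp_slope (-θ)).comp tendsto_one_div_succ).neg.const_mul s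
      rw [neg_neg] at this
      refine this.congr fun n => ?_
      have h0 := (hr n).ne'
      change s * -((Real.exp (1 / r n * -θ) - 1) / (1 / r n)) = _
      rw [mul_comm (1 / r n)]
      field_simp
      ring
    have h3 := ((tendsto_const_nhds (x := p)).add tendsto_one_div_add_atTop_nhds_zero_nat).add h2
      |>.add (h1.div_const θ)
    have h4 : lkExp b s Λ θ / θ = p + 0 + s * θ +
        (∫ x, (Real.exp (θ * x) - 1 - θ * x) ∂Λ) / θ := by
      rw [heq]
      field_simp
      ring
    rw [h4]
    exact h3
  refine exists_measure_of_tendsto_expMoment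
    (U := fun n => Measure.resolvent (ENNReal.ofReal (a n)) (ν n))
    (G := fun n θ => (κ n θ)⁻¹) (fun n => ae_nonneg_resolvent _ (hνnn n))
    (fun n θ hθ => inv_pos.2 (hκ n θ hθ)) (fun n θ hθ => ?_)
    (fun θ hθ => div_pos hθ (hpos θ hθ)) (fun θ hθ => ?_)
  · rw [expMoment_resolvent (ENNReal.ofReal_pos.2 (ha n)).ne' ENNReal.ofReal_ne_top, hνE n θ hθ,
      ← ENNReal.ofReal_sub, haκ n θ hθ, ENNReal.ofReal_inv_of_pos (hκ n θ hθ)]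
    refine add_nonneg (mul_nonneg (mul_nonneg hs (hr n).le) (Real.exp_nonneg _)) ?_
    refine setIntegral_nonneg measurableSet_Iio fun x hx => ?_
    have := hZneg n x hx
    have : Real.exp (θ * x) ≤ 1 := Real.exp_le_one_iff.2 (by nlinarith)
    exact div_nonneg (by linarith) hθ.le
  · rw [← inv_div]
    exact (hlim θ hθ).inv₀ (div_pos (hpos θ hθ) hθ).ne'

end IsNegLevyMeasure

/-! ### Laplace transforms of causal functions -/

/-- A nonnegative function which vanishes on `(-∞, 0)` and is right-continuous on `[0, ∞)`. -/
structure IsCausal (W : ℝ → ℝ) : Prop where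
  nonneg : ∀ x, 0 ≤ W x
  eq_zero : ∀ x < 0, W x = 0
  right_continuous : ∀ x, 0 ≤ x → ContinuousWithinAt W (Ici x) x

theorem IsScaleFunction.isCausal {ψ : ℝ → ℝ} {q : ℝ} {W : ℝ → ℝ} (h : IsScaleFunction ψ q W) :
    IsCausal W := ⟨h.nonneg, h.eq_zero, h.right_continuous⟩

namespace IsCausal

variable {W V : ℝ → ℝ}

theorem continuousWithinAt (hW : IsCausal W) (x : ℝ) : ContinuousWithinAt W (Ici x) x := by
  rcases le_or_gt 0 x with hx | hx
  · exact hW.right_continuous x hx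
  · refine (continuousAt_const (y := (0 : ℝ)).congr ?_).continuousWithinAt
    filter_upwards [Iio_mem_nhds hx] with y hy
    exact (hW.eq_zero y hy).symm

theorem aemeasurable_of_integrableOn {β : ℝ}
    (hi : IntegrableOn (fun x => Real.exp (-β * x) * W x) (Ioi 0)) :
    AEMeasurable W (volume.restrict (Ioi 0)) := by
  have h := hi.aemeasurable.const_mul 1 |>.mul
    (Measurable.aemeasurable (by fun_prop : Measurable fun x : ℝ => Real.exp (β * x)))
  refine h.congr (ae_of_all _ fun x => ?_)
  simp only [Pi.mul_apply, one_mul]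
  rw [mul_right_comm, ← Real.exp_add]
  simp

theorem expMoment_withDensity (hW : IsCausal W) {β : ℝ}
    (hi : IntegrableOn (fun x => Real.exp (-β * x) * W x) (Ioi 0)) :
    expMoment ((volume.restrict (Ioi 0)).withDensity fun x => ENNReal.ofReal (W x)) (-β) =
      ENNReal.ofReal (∫ x in Ioi 0, Real.exp (-β * x) * W x) := by
  rw [expMoment, lintegral_withDensity_eq_lintegral_mul₀
    (aemeasurable_of_integrableOn hi).ennreal_ofReal (by fun_prop),
    ofReal_integral_eq_lintegral_ofReal hi
      (ae_of_all _ fun x => mul_nonneg (Real.exp_nonneg _) (hW.nonneg x))]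
  congr with x
  rw [Pi.mul_apply, ENNReal.ofReal_mul (Real.exp_nonneg _), mul_comm]

/-- Equality of the measures `W dx` and `V dx` gives equality almost everywhere, and
right-continuity upgrades it to every point. -/
theorem eq_of_laplace_eq (hW : IsCausal W) (hV : IsCausal V) {β₀ : ℝ}
    (hWi : ∀ β, β₀ ≤ β → IntegrableOn (fun x => Real.exp (-β * x) * W x) (Ioi 0))
    (hVi : ∀ β, β₀ ≤ β → IntegrableOn (fun x => Real.exp (-β * x) * V x) (Ioi 0))
    (h : ∀ β, β₀ ≤ β → ∫ x in Ioi 0, Real.exp (-β * x) * W x =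
      ∫ x in Ioi 0, Real.exp (-β * x) * V x) : W = V := by
  have hnn : ∀ f : ℝ → ℝ≥0∞, ∀ᵐ x ∂((volume.restrict (Ioi (0 : ℝ))).withDensity f), 0 ≤ x :=
    fun f => ae_withDensity_of_ae ((ae_restrict_iff' measurableSet_Ioi).2
      (ae_of_all _ fun x hx => le_of_lt hx)) f
  have hmeas : (volume.restrict (Ioi 0)).withDensity (fun x => ENNReal.ofReal (W x)) =
      (volume.restrict (Ioi 0)).withDensity (fun x => ENNReal.ofReal (V x)) := by
    refine eq_of_expMoment_neg_eq (β₀ := β₀) (hnn _) (hnn _) ?_ fun β hβ => ?_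
    · rw [hW.expMoment_withDensity (hWi β₀ le_rfl)]; exact ENNReal.ofReal_ne_top
    · rw [hW.expMoment_withDensity (hWi β hβ), hV.expMoment_withDensity (hVi β hβ), h β hβ]
  rw [withDensity_eq_iff_of_sigmaFinite
    (aemeasurable_of_integrableOn (hWi β₀ le_rfl)).ennreal_ofReal
    (aemeasurable_of_integrableOn (hVi β₀ le_rfl)).ennreal_ofReal] at hmeas
  have hae : ∀ᵐ x, x ∈ Ioi (0 : ℝ) → W x = V x := by
    refine (ae_restrict_iff' measurableSet_Ioi).1 ?_
    filter_upwards [hmeas] with x hx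
    exact (ENNReal.ofReal_eq_ofReal_iff (hW.nonneg x) (hV.nonneg x)).1 hx
  ext x
  rcases lt_or_ge x 0 with hx | hx
  · rw [hW.eq_zero x hx, hV.eq_zero x hx]
  have hfreq : ∃ᶠ y in 𝓝[>] x, W y - V y ∈ ({0} : Set ℝ) := by
    intro hev
    obtain ⟨u, hu, hsub⟩ := mem_nhdsGT_iff_exists_Ioo_subset.1 hev
    have h0 : volume (Ioo x u) = 0 := by
      refine measure_mono_null (fun y hy => ?_) hae
      intro hyW
      exact hsub hy (by simp [hyW (lt_of_le_of_lt hx hy.1)])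
    rw [Real.volume_Ioo, ENNReal.ofReal_eq_zero] at h0
    linarith [mem_Ioi.1 hu]
  have hlim : Tendsto (fun y => W y - V y) (𝓝[>] x) (𝓝 (W x - V x)) :=
    ((hW.continuousWithinAt x).sub (hV.continuousWithinAt x)).mono_left
      (nhdsWithin_mono _ Ioi_subset_Ici_self)
  exact sub_eq_zero.1 (isClosed_singleton.mem_of_frequently_of_tendsto hfreq hlim)

/-! ### Convolution powers of an increasing causal function -/

theorem convPow_nonneg (hW : IsCausal W) (k : ℕ) (x : ℝ) : 0 ≤ convPow W k x := by
  induction k generalizing x with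
  | zero => exact hW.nonneg x
  | succ k ih =>
    rw [convPow, convolution]
    exact integral_nonneg fun t => mul_nonneg (ih t) (hW.nonneg _)

theorem convPow_eq_zero (hW : IsCausal W) (k : ℕ) {x : ℝ} (hx : x < 0) : convPow W k x = 0 := by
  induction k generalizing x with
  | zero => exact hW.eq_zero x hx
  | succ k ih =>
    rw [convPow, convolution]
    refine integral_eq_zero_of_ae (ae_of_all _ fun t => ?_)
    simp only [ContinuousLinearMap.mul_apply', Pi.zero_apply]
    rcases lt_or_ge t 0 with ht | ht
    · rw [ih ht, zero_mul]
    · rw [hW.eq_zero _ (by linarith), mul_zero]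

theorem measurable_convPow (hm : Monotone W) (k : ℕ) : Measurable (convPow W k) := by
  induction k with
  | zero => exact hm.measurable
  | succ k ih =>
    have h : StronglyMeasurable (Function.uncurry fun x t : ℝ => convPow W k t * W (x - t)) :=
      ((ih.comp measurable_snd).mul
        (hm.measurable.comp (measurable_fst.sub measurable_snd))).stronglyMeasurable
    exact h.integral_prod_right.measurable

/-- The majorant depends on `T` alone. With `T = y` it gives the induction step of `convPow_le`;
with `T` slightly larger it dominates uniformly for right-continuity. -/
theorem convolution_integrand_le (hW : IsCausal W) (hm : Monotone W) {k : ℕ}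
    (hb : ∀ x, 0 ≤ x → convPow W k x ≤ x ^ k / k ! * W x ^ (k + 1)) {y T : ℝ} (hy : y ≤ T) (t : ℝ) :
    convPow W k t * W (y - t) ≤
      (Icc 0 T).indicator (fun t => t ^ k / k ! * W T ^ (k + 2)) t := by
  by_cases ht : t ∈ Icc 0 T
  · rw [indicator_of_mem ht]
    have h1 : W (y - t) ≤ W T := hm (by linarith [ht.1])
    have h2 : W t ≤ W T := hm ht.2
    have ht0 := ht.1
    calc convPow W k t * W (y - t) ≤ (t ^ k / k ! * W t ^ (k + 1)) * W T :=
          mul_le_mul (hb t ht.1) h1 (hW.nonneg _)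
            (mul_nonneg (by positivity) (pow_nonneg (hW.nonneg _) _))
      _ ≤ (t ^ k / k ! * W T ^ (k + 1)) * W T := by
          have := hW.nonneg T
          have := hW.nonneg t
          gcongr
      _ = _ := by ring
  · rw [indicator_of_notMem ht]
    rw [mem_Icc, not_and_or, not_le, not_le] at ht
    rcases ht with ht | ht
    · rw [hW.convPow_eq_zero k ht, zero_mul]
    · rw [hW.eq_zero _ (by linarith), mul_zero]

theorem integrable_indicator_pow (k : ℕ) (C T : ℝ) :
    Integrable ((Icc 0 T).indicator fun t : ℝ => t ^ k / k ! * C) :=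
  (Continuous.integrableOn_Icc (by fun_prop)).integrable_indicator measurableSet_Icc

/-- Monotonicity pulls the values of `W` out as `W x`, and `∫_0^x t^k/k! dt = x^{k+1}/(k+1)!`. -/
theorem convPow_le (hW : IsCausal W) (hm : Monotone W) (k : ℕ) {x : ℝ} (hx : 0 ≤ x) :
    convPow W k x ≤ x ^ k / k ! * W x ^ (k + 1) := by
  induction k generalizing x with
  | zero => simp [convPow]
  | succ k ih =>
    rw [convPow, convolution]
    refine (integral_mono_of_nonneg
      (ae_of_all _ fun t => mul_nonneg (hW.convPow_nonneg k t) (hW.nonneg _))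
      (integrable_indicator_pow k (W x ^ (k + 2)) x)
      (ae_of_all _ fun t => hW.convolution_integrand_le hm (fun y hy => ih hy) le_rfl t)).trans ?_
    rw [integral_indicator measurableSet_Icc, integral_Icc_eq_integral_Ioc,
      ← intervalIntegral.integral_of_le hx, intervalIntegral.integral_mul_const,
      intervalIntegral.integral_div, integral_pow, Nat.factorial_succ]
    refine le_of_eq ?_
    have : (k ! : ℝ) ≠ 0 := by positivity
    push_cast
    field_simp
    ring

theorem continuousWithinAt_convPow (hW : IsCausal W) (hm : Monotone W) (k : ℕ) (x : ℝ) :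
    ContinuousWithinAt (convPow W k) (Ici x) x := by
  cases k with
  | zero => exact hW.continuousWithinAt x
  | succ k =>
    refine continuousWithinAt_of_dominated
      (F := fun y t => convPow W k t * W (y - t))
      (bound := (Icc 0 (x + 1)).indicator fun t => t ^ k / k ! * W (x + 1) ^ (k + 2))
      ?_ ?_ (integrable_indicator_pow _ _ _) ?_
    · exact Eventually.of_forall fun y => ((measurable_convPow hm k).mul
        (hm.measurable.comp (by fun_prop))).aestronglyMeasurable
    · have h1 : ∀ᶠ y in 𝓝[Ici x] x, y ≤ x + 1 :=
        mem_nhdsWithin_of_mem_nhds (Iic_mem_nhds (by linarith))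
      filter_upwards [h1] with y hy
      refine ae_of_all _ fun t => ?_
      rw [Real.norm_of_nonneg (mul_nonneg (hW.convPow_nonneg k t) (hW.nonneg _))]
      exact hW.convolution_integrand_le hm (fun y hy => hW.convPow_le hm k hy) hy t
    · refine ae_of_all _ fun t => continuousWithinAt_const.mul ?_
      exact ContinuousWithinAt.comp (t := Ici (x - t)) (hW.continuousWithinAt (x - t))
        (by fun_prop) fun y hy => sub_le_sub_right hy t

/-- The weight `e^{-βx}` is multiplicative, so it distributes over the convolution. The exponent is
`k + 1` because `convPow W 0` is `W` itself. -/
theorem laplace_convPow (hW : IsCausal W) {β : ℝ}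
    (hi : IntegrableOn (fun x => Real.exp (-β * x) * W x) (Ioi 0)) (k : ℕ) :
    Integrable (fun x => Real.exp (-β * x) * convPow W k x) ∧
      ∫ x, Real.exp (-β * x) * convPow W k x =
        (∫ x in Ioi 0, Real.exp (-β * x) * W x) ^ (k + 1) := by
  have hz : ∀ x ∉ Ici (0 : ℝ), Real.exp (-β * x) * W x = 0 := fun x hx => by
    rw [hW.eq_zero x (not_le.1 hx), mul_zero]
  have h0 : Integrable fun x => Real.exp (-β * x) * W x :=
    (integrableOn_iff_integrable_of_support_subset (s := Ici 0) fun x hx => by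
      by_contra h; exact hx (hz x h)).1 (hi.congr_set_ae Ioi_ae_eq_Ici.symm)
  have h0' : ∫ x, Real.exp (-β * x) * W x = ∫ x in Ioi 0, Real.exp (-β * x) * W x := by
    rw [← integral_Ici_eq_integral_Ioi, setIntegral_eq_integral_of_forall_compl_eq_zero hz]
  induction k with
  | zero => exact ⟨h0, by rw [zero_add, pow_one]; exact h0'⟩
  | succ k ih =>
    have heq : (fun x => Real.exp (-β * x) * convPow W (k + 1) x) =
        convolution (fun x => Real.exp (-β * x) * convPow W k x)
          (fun x => Real.exp (-β * x) * W x) (ContinuousLinearMap.mul ℝ ℝ) volume := by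
      ext x
      rw [convPow, convolution, convolution, ← integral_const_mul]
      congr with t
      simp only [ContinuousLinearMap.mul_apply']
      rw [show -β * x = -β * t + -β * (x - t) by ring, Real.exp_add]
      ring
    refine ⟨by rw [heq]; exact ih.1.integrable_convolution _ h0, ?_⟩
    rw [heq, integral_convolution _ ih.1 h0, ih.2, h0', ContinuousLinearMap.mul_apply',
      ← pow_succ]

theorem setIntegral_convPow (hW : IsCausal W) (β : ℝ) (k : ℕ) :
    ∫ x in Ioi 0, Real.exp (-β * x) * convPow W k x = ∫ x, Real.exp (-β * x) * convPow W k x := by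
  rw [← integral_Ici_eq_integral_Ioi]
  refine setIntegral_eq_integral_of_forall_compl_eq_zero fun x hx => ?_
  rw [hW.convPow_eq_zero k (not_le.1 hx), mul_zero]

theorem summable_bound (C q T : ℝ) :
    Summable fun k : ℕ => q ^ k * (T ^ k / k ! * C ^ (k + 1)) := by
  refine ((Real.summable_pow_div_factorial (q * T * C)).mul_right C).congr fun k => ?_
  rw [mul_pow, mul_pow]
  ring

theorem convPow_le_of_le (hW : IsCausal W) (hm : Monotone W) (k : ℕ) {x T : ℝ} (hx : 0 ≤ x)
    (hT : x ≤ T) : convPow W k x ≤ T ^ k / k ! * W T ^ (k + 1) := by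
  refine (hW.convPow_le hm k hx).trans ?_
  have := hW.nonneg x
  have := hm hT
  have := hW.nonneg T
  have := hx.trans hT
  gcongr

theorem summable_norm (hW : IsCausal W) (hm : Monotone W) (q : ℂ) (x : ℝ) :
    Summable fun k : ℕ => ‖q ^ k * (convPow W k x : ℂ)‖ := by
  rcases lt_or_ge x 0 with hx | hx
  · simp [hW.convPow_eq_zero _ hx, summable_zero]
  · refine Summable.of_nonneg_of_le (fun k => norm_nonneg _) (fun k => ?_)
      (summable_bound (W x) ‖q‖ x)
    rw [norm_mul, norm_pow, Complex.norm_real, Real.norm_of_nonneg (hW.convPow_nonneg k x)]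
    gcongr
    exact hW.convPow_le hm k hx

theorem isCausal_series (hW : IsCausal W) (hm : Monotone W) {q : ℝ} (hq : 0 ≤ q) :
    IsCausal fun x => ∑' k : ℕ, q ^ k * convPow W k x := by
  refine ⟨fun x => tsum_nonneg fun k => mul_nonneg (pow_nonneg hq k) (hW.convPow_nonneg k x),
    fun x hx => ?_, fun x hx => ?_⟩
  · simp [hW.convPow_eq_zero _ hx]
  · refine tendsto_tsum_of_dominated_convergence (summable_bound (W (x + 1)) q (x + 1))
      (fun k => ((hW.continuousWithinAt_convPow hm k x).const_smul (q ^ k))) ?_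
    have h1 : ∀ᶠ y in 𝓝[Ici x] x, y ≤ x + 1 :=
      mem_nhdsWithin_of_mem_nhds (Iic_mem_nhds (by linarith))
    filter_upwards [h1, self_mem_nhdsWithin] with y hy hy' k
    rw [Real.norm_of_nonneg (mul_nonneg (pow_nonneg hq k) (hW.convPow_nonneg k y))]
    gcongr
    exact hW.convPow_le_of_le hm k (hx.trans hy') hy

/-- Termwise integration gives `∑ q^k/L^{k+1}`, a geometric series of ratio `q/L < 1`. -/
theorem laplace_series (hW : IsCausal W) {β q L : ℝ}
    (hi : IntegrableOn (fun x => Real.exp (-β * x) * W x) (Ioi 0))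
    (hL : ∫ x in Ioi 0, Real.exp (-β * x) * W x = 1 / L) (hq : 0 ≤ q) (hqL : q < L) :
    ∫ x in Ioi 0, Real.exp (-β * x) * ∑' k : ℕ, q ^ k * convPow W k x = 1 / (L - q) := by
  have hL0 : 0 < L := hq.trans_lt hqL
  have hint : ∀ k : ℕ, ∫ x in Ioi 0, Real.exp (-β * x) * (q ^ k * convPow W k x) =
      1 / L * (q / L) ^ k := fun k => by
    simp_rw [mul_left_comm _ (q ^ k)]
    rw [integral_const_mul, hW.setIntegral_convPow, (hW.laplace_convPow hi k).2, hL, pow_succ,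
      div_pow, div_pow, one_pow]
    ring
  have hgeo : HasSum (fun k : ℕ => 1 / L * (q / L) ^ k) (1 / L * (1 - q / L)⁻¹) :=
    (hasSum_geometric_of_lt_one (by positivity) ((div_lt_one hL0).2 hqL)).mul_left _
  have hsum := hasSum_integral_of_summable_integral_norm (μ := volume.restrict (Ioi (0 : ℝ)))
    (F := fun (k : ℕ) x => Real.exp (-β * x) * (q ^ k * convPow W k x))
    (fun k => by
      simp_rw [mul_left_comm _ (q ^ k)]
      exact ((hW.laplace_convPow hi k).1.const_mul _).integrableOn)
    (hgeo.summable.congr fun k => by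
      rw [← hint]
      congr with x
      rw [Real.norm_of_nonneg]
      exact mul_nonneg (Real.exp_nonneg _)
        (mul_nonneg (pow_nonneg hq k) (hW.convPow_nonneg k x)))
  simp_rw [hint, tsum_mul_left] at hsum
  rw [hsum.unique hgeo]
  have h1 : L - q ≠ 0 := by linarith
  have h2 := hL0.ne'
  field_simp

end IsCausal

/-! ### The right inverse of the Laplace exponent -/

section RightInverse

variable {ψ : ℝ → ℝ}

theorem bddAbove_level (htop : Tendsto ψ atTop atTop) (q : ℝ) :
    BddAbove {θ : ℝ | 0 ≤ θ ∧ ψ θ = q} := by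
  obtain ⟨B, hB⟩ := eventually_atTop.1 (htop.eventually_gt_atTop q)
  refine ⟨B, fun θ hθ => ?_⟩
  by_contra h
  exact (hB θ (not_le.1 h).le).ne' hθ.2

theorem exists_level_ge (hc : ContinuousOn ψ (Ici 0)) (htop : Tendsto ψ atTop atTop) {q β : ℝ}
    (hβ : 0 ≤ β) (h : ψ β ≤ q) : ∃ θ, β ≤ θ ∧ ψ θ = q := by
  obtain ⟨T, hT, hT'⟩ := ((htop.eventually_ge_atTop q).and (eventually_ge_atTop β)).exists
  obtain ⟨θ, hθ, hθq⟩ := intermediate_value_Icc hT'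
    (hc.mono fun x hx => hβ.trans hx.1) ⟨h, hT⟩
  exact ⟨θ, hθ.1, hθq⟩

theorem rightInverse_nonneg (q : ℝ) : 0 ≤ rightInverse ψ q :=
  Real.sSup_nonneg fun _ hθ => hθ.1

/-- Convexity is not needed: if `ψ β ≤ q`, continuity and growth at infinity give a solution of `ψ θ
= q` with `θ ≥ β`, so `Φ(q) ≥ β`. -/
theorem lt_of_rightInverse_lt (hc : ContinuousOn ψ (Ici 0)) (htop : Tendsto ψ atTop atTop)
    {q β : ℝ} (h : rightInverse ψ q < β) : q < ψ β := by
  by_contra hle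
  have hβ : 0 ≤ β := (rightInverse_nonneg q).trans h.le
  obtain ⟨θ, hθ, hθq⟩ := exists_level_ge hc htop hβ (not_lt.1 hle)
  exact absurd (le_csSup (bddAbove_level htop q) ⟨hβ.trans hθ, hθq⟩) (not_le.2 (h.trans_le hθ))

theorem rightInverse_mem (hc : ContinuousOn ψ (Ici 0)) (htop : Tendsto ψ atTop atTop)
    (h0 : ψ 0 = 0) {q : ℝ} (hq : 0 ≤ q) : ψ (rightInverse ψ q) = q := by
  have hne : {θ : ℝ | 0 ≤ θ ∧ ψ θ = q}.Nonempty := by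
    obtain ⟨θ, hθ, hθq⟩ := exists_level_ge hc htop le_rfl (h0.le.trans hq)
    exact ⟨θ, hθ, hθq⟩
  have hcl : IsClosed {θ : ℝ | 0 ≤ θ ∧ ψ θ = q} := by
    have : {θ : ℝ | 0 ≤ θ ∧ ψ θ = q} = Ici 0 ∩ ψ ⁻¹' {q} := rfl
    rw [this]
    exact hc.preimage_isClosed_of_isClosed isClosed_Ici isClosed_singleton
  exact (hcl.csSup_mem hne (bddAbove_level htop q)).2

theorem rightInverse_zero_le (hc : ContinuousOn ψ (Ici 0)) (htop : Tendsto ψ atTop atTop)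
    (h0 : ψ 0 = 0) {q : ℝ} (hq : 0 ≤ q) : rightInverse ψ 0 ≤ rightInverse ψ q := by
  refine csSup_le ⟨0, le_rfl, h0⟩ fun θ hθ => ?_
  obtain ⟨θ', hθ', hθq⟩ := exists_level_ge hc htop hθ.1 (hθ.2.le.trans hq)
  exact hθ'.trans (le_csSup (bddAbove_level htop q) ⟨hθ.1.trans hθ', hθq⟩)

end RightInverse

/-! ### Scale functions as convolution series -/

theorem IsScaleFunction.unique {ψ : ℝ → ℝ} {q : ℝ} {W V : ℝ → ℝ} (hW : IsScaleFunction ψ q W)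
    (hV : IsScaleFunction ψ q V) : W = V := by
  have h : ∀ β, rightInverse ψ q + 1 ≤ β → rightInverse ψ q < β := fun β hβ => by linarith
  refine hW.isCausal.eq_of_laplace_eq hV.isCausal (β₀ := rightInverse ψ q + 1)
    (fun β hβ => hW.integrable β (h β hβ)) (fun β hβ => hV.integrable β (h β hβ)) fun β hβ => ?_
  rw [hW.laplace β (h β hβ), hV.laplace β (h β hβ)]

theorem IsScaleFunction.scaleFunction_eq {ψ : ℝ → ℝ} {q : ℝ} {W : ℝ → ℝ}
    (hW : IsScaleFunction ψ q W) : scaleFunction ψ q = W :=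
  (Classical.epsilon_spec (p := IsScaleFunction ψ q) ⟨W, hW⟩).unique hW

theorem isScaleFunction_series {ψ : ℝ → ℝ} (hc : ContinuousOn ψ (Ici 0))
    (htop : Tendsto ψ atTop atTop) (h0 : ψ 0 = 0) {W : ℝ → ℝ} (hW : IsScaleFunction ψ 0 W)
    (hm : Monotone W) {q : ℝ} (hq : 0 ≤ q) :
    IsScaleFunction ψ q fun x => ∑' k : ℕ, q ^ k * convPow W k x := by
  have hS := hW.isCausal.isCausal_series hm hq
  have hL : ∀ β, rightInverse ψ q < β → ∫ x in Ioi 0,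
      Real.exp (-β * x) * ∑' k : ℕ, q ^ k * convPow W k x = 1 / (ψ β - q) := fun β hβ => by
    have h1 := (rightInverse_zero_le hc htop h0 hq).trans_lt hβ
    have h2 := hW.laplace β h1
    rw [sub_zero] at h2
    exact hW.isCausal.laplace_series (hW.integrable β h1) h2 hq
      (lt_of_rightInverse_lt hc htop hβ)
  refine ⟨hS.nonneg, hS.eq_zero, hS.right_continuous, fun β hβ => ?_, hL⟩
  -- The Bochner integral of a non-integrable function is `0` by convention, whereas here its value
  -- is positive.
  refine not_imp_comm.1 integral_undef ?_
  rw [hL β hβ]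
  exact (one_div_pos.2 (sub_pos.2 (lt_of_rightInverse_lt hc htop hβ))).ne'

/-- Weierstrass on the ball of radius `‖q‖ + 1`, with the absolutely convergent series at that
radius as majorant. -/
theorem differentiable_series {a : ℕ → ℝ}
    (ha : ∀ q : ℂ, Summable fun k : ℕ => ‖q ^ k * (a k : ℂ)‖) :
    Differentiable ℂ fun q : ℂ => ∑' k : ℕ, q ^ k * (a k : ℂ) := by
  intro q
  have h := Complex.differentiableOn_tsum_of_summable_norm (U := Metric.ball (0 : ℂ) (‖q‖ + 1))
    (F := fun (k : ℕ) (w : ℂ) => w ^ k * (a k : ℂ)) (ha ((‖q‖ + 1 : ℝ) : ℂ))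
    (fun k => by fun_prop) Metric.isOpen_ball (fun k w hw => by
      rw [norm_mul, norm_mul, norm_pow, norm_pow, Complex.norm_real (‖q‖ + 1),
        Real.norm_of_nonneg (by positivity : 0 ≤ ‖q‖ + 1)]
      gcongr
      simpa using (mem_ball_zero_iff.1 hw).le)
  exact (h q (by simp)).differentiableAt (Metric.isOpen_ball.mem_nhds (by simp))

theorem scaleFunctionsExtend_of_monotone {ψ : ℝ → ℝ} (hc : ContinuousOn ψ (Ici 0))
    (htop : Tendsto ψ atTop atTop) (h0 : ψ 0 = 0) {W : ℝ → ℝ} (hW : IsScaleFunction ψ 0 W)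
    (hm : Monotone W) : ScaleFunctionsExtend ψ := by
  have hWeq := hW.scaleFunction_eq
  have hsum := hW.isCausal.summable_norm hm
  refine ⟨fun q hq => ⟨_, isScaleFunction_series hc htop h0 hW hm hq, fun V hV =>
    hV.unique (isScaleFunction_series hc htop h0 hW hm hq)⟩, fun x hx k => ?_, fun q x => ?_,
    fun q hq x => ?_, fun x => ?_⟩
  · rw [hWeq]; exact hW.isCausal.convPow_le hm k hx
  · rw [hWeq]; exact hsum q x
  · rw [(isScaleFunction_series hc htop h0 hW hm hq).scaleFunction_eq, complexScaleFunction, hWeq]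
    push_cast
    rfl
  · simp only [complexScaleFunction, hWeq]
    exact differentiable_series fun q => hsum q x

/-! ### Existence of the `0`-scale function -/

/-- Take `W(x) = e^{cx} U[0,x]`. By Tonelli, `∫_0^∞ e^{-θx} U[0,x] dx = Û(θ)/θ = 1/ψ(c+θ)`. Since `c
≥ 0`, both factors are increasing on the line. -/
theorem isScaleFunction_of_potential {ψ : ℝ → ℝ} {U : Measure ℝ} [SFinite U]
    (hU0 : ∀ᵐ x ∂U, 0 ≤ x)
    (hpos : ∀ θ, 0 < θ → 0 < ψ (rightInverse ψ 0 + θ))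
    (hU : ∀ θ, 0 < θ →
      expMoment U (-θ) = ENNReal.ofReal (θ / ψ (rightInverse ψ 0 + θ))) :
    ∃ W, IsScaleFunction ψ 0 W ∧ Monotone W := by
  set c := rightInverse ψ 0 with hc
  have hc0 : 0 ≤ c := rightInverse_nonneg 0
  have hUneg : ∀ x < 0, U (Iic x) = 0 := fun x hx => by
    refine measure_mono_null (fun y hy => ?_) hU0
    exact not_le.2 (lt_of_le_of_lt hy hx)
  have hUfin : ∀ x, U (Iic x) ≠ ∞ := fun x => by
    have h1 : U (Iic x) ≤ U {y | ENNReal.ofReal (Real.exp (-1 * x)) ≤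
        ENNReal.ofReal (Real.exp (-1 * y))} := measure_mono fun y hy =>
      ENNReal.ofReal_le_ofReal (Real.exp_le_exp.2 (by linarith [mem_Iic.1 hy]))
    have h2 := meas_ge_le_lintegral_div (μ := U) (f := fun y => ENNReal.ofReal (Real.exp (-1 * y)))
      (by fun_prop) (ENNReal.ofReal_pos.2 (Real.exp_pos (-1 * x))).ne' ENNReal.ofReal_ne_top
    refine ne_top_of_le_ne_top ?_ (h1.trans h2)
    refine (ENNReal.div_lt_top ?_ (ENNReal.ofReal_pos.2 (Real.exp_pos (-1 * x))).ne').ne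
    change expMoment U (-1) ≠ ∞
    rw [hU 1 one_pos]
    exact ENNReal.ofReal_ne_top
  let W : ℝ → ℝ := fun x => Real.exp (c * x) * (U (Iic x)).toReal
  have hWm : Monotone W := fun x y hxy => by
    change Real.exp (c * x) * (U (Iic x)).toReal ≤ Real.exp (c * y) * (U (Iic y)).toReal
    gcongr
    exact hUfin y
  have hW0 : ∀ x, 0 ≤ W x := fun x => mul_nonneg (Real.exp_nonneg _) ENNReal.toReal_nonneg
  have hlint : ∀ θ, 0 < θ → ∫⁻ x in Ioi 0, ENNReal.ofReal (Real.exp (-(c + θ) * x) * W x) =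
      ENNReal.ofReal (1 / ψ (c + θ)) := by
    intro θ hθ
    have hS : MeasurableSet {p : ℝ × ℝ | p.2 ≤ p.1} := measurableSet_le measurable_snd measurable_fst
    have h1 : ∀ x : ℝ, ENNReal.ofReal (Real.exp (-(c + θ) * x) * W x) =
        ∫⁻ z, {p : ℝ × ℝ | p.2 ≤ p.1}.indicator
          (fun p => ENNReal.ofReal (Real.exp (-θ * p.1))) (x, z) ∂U := fun x => by
      have h2 : Real.exp (-(c + θ) * x) * W x = Real.exp (-θ * x) * (U (Iic x)).toReal := by
        change _ * (_ * _) = _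
        rw [← mul_assoc, ← Real.exp_add]
        ring_nf
      rw [h2, ENNReal.ofReal_mul (Real.exp_nonneg _), ENNReal.ofReal_toReal (hUfin x),
        ← setLIntegral_const, ← lintegral_indicator measurableSet_Iic]
      rfl
    simp_rw [h1]
    rw [lintegral_lintegral_swap]
    · have h3 : ∀ᵐ z ∂U, ∫⁻ x in Ioi 0, {p : ℝ × ℝ | p.2 ≤ p.1}.indicator
          (fun p => ENNReal.ofReal (Real.exp (-θ * p.1))) (x, z) =
          ENNReal.ofReal (1 / θ) * ENNReal.ofReal (Real.exp (-θ * z)) := by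
        filter_upwards [hU0] with z hz
        have h4 : ∀ x : ℝ, {p : ℝ × ℝ | p.2 ≤ p.1}.indicator
            (fun p => ENNReal.ofReal (Real.exp (-θ * p.1))) (x, z) =
            (Ici z).indicator (fun x => ENNReal.ofReal (Real.exp (-θ * x))) x := fun x => by
          simp only [indicator_apply, Set.mem_ofPred_eq, mem_Ici]
        simp_rw [h4]
        rw [← setLIntegral_congr (Ioi_ae_eq_Ici (a := (0 : ℝ))).symm,
          lintegral_indicator measurableSet_Ici, Measure.restrict_restrict measurableSet_Ici,
          Ici_inter_Ici, max_eq_left hz, setLIntegral_congr (Ioi_ae_eq_Ici (a := z)).symm,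
          ← ofReal_integral_eq_lintegral_ofReal
            (integrableOn_exp_mul_Ioi (neg_neg_of_pos hθ) z) (ae_of_all _ fun x => Real.exp_nonneg _),
          integral_exp_mul_Ioi (neg_neg_of_pos hθ), ← ENNReal.ofReal_mul (by positivity)]
        congr 1
        field_simp
      rw [lintegral_congr_ae h3, lintegral_const_mul _ (by fun_prop)]
      change _ * expMoment U (-θ) = _
      rw [hU θ hθ, ← ENNReal.ofReal_mul (by positivity)]
      congr 1
      have := (hpos θ hθ).ne'
      field_simp
    · exact (Measurable.indicator (by fun_prop) hS).aemeasurable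
  have hmeas : ∀ β, AEStronglyMeasurable (fun x => Real.exp (-β * x) * W x)
      (volume.restrict (Ioi 0)) := fun β =>
    ((by fun_prop : Measurable fun x => Real.exp (-β * x)).mul hWm.measurable).aestronglyMeasurable
  have hnn : ∀ β, ∀ x, 0 ≤ Real.exp (-β * x) * W x := fun β x =>
    mul_nonneg (Real.exp_nonneg _) (hW0 x)
  refine ⟨W, ⟨hW0, fun x hx => ?_, fun x hx => ?_, fun β hβ => ?_, fun β hβ => ?_⟩, hWm⟩
  · change _ * _ = _
    rw [hUneg x hx, ENNReal.toReal_zero, mul_zero]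
  · refine ContinuousWithinAt.mul (by fun_prop) ?_
    rw [← continuousWithinAt_Ioi_iff_Ici]
    have := tendsto_measure_biInter_gt (μ := U) (s := fun y : ℝ => Iic y) (a := x)
      (fun r _ => measurableSet_Iic.nullMeasurableSet) (fun i j _ hij => Iic_subset_Iic.2 hij)
      ⟨x + 1, by simp, hUfin _⟩
    have hI : ⋂ r, ⋂ (_ : r > x), Iic r = Iic x := by
      ext y
      simp only [mem_iInter, mem_Iic]
      exact ⟨fun h => le_of_forall_gt_imp_ge_of_dense h, fun h r hr => h.trans hr.le⟩
    rw [hI] at this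
    exact (ENNReal.tendsto_toReal (hUfin x)).comp this
  · refine ⟨hmeas β, ?_⟩
    rw [hasFiniteIntegral_iff_ofReal (ae_of_all _ (hnn β))]
    have := hlint (β - c) (sub_pos.2 hβ)
    rw [add_sub_cancel] at this
    rw [this]
    exact ENNReal.ofReal_lt_top
  · have h1 := hlint (β - c) (sub_pos.2 hβ)
    have h2 := hpos (β - c) (sub_pos.2 hβ)
    rw [add_sub_cancel] at h1 h2
    rw [integral_eq_lintegral_of_nonneg_ae (ae_of_all _ (hnn β)) (hmeas β), h1,
      ENNReal.toReal_ofReal (one_div_pos.2 h2).le, sub_zero]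

/-- The scale functions belonging to the Laplace exponent of a spectrally negative process. -/
theorem IsNegLevyMeasure.scaleFunctionsExtend {Λ : Measure ℝ} (hΛ : IsNegLevyMeasure Λ) {b s : ℝ}
    (hs : 0 ≤ s) {ψ : ℝ → ℝ} (hψ : ∀ θ, 0 ≤ θ → ψ θ = lkExp b s Λ θ)
    (htop : Tendsto ψ atTop atTop) : ScaleFunctionsExtend ψ := by
  have hc : ContinuousOn ψ (Ici 0) := (hΛ.continuousOn_lkExp b s).congr fun θ hθ => hψ θ hθ
  have h0 : ψ 0 = 0 := by rw [hψ 0 le_rfl, IsNegLevyMeasure.lkExp_zero]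
  set c := rightInverse ψ 0 with hcdef
  -- Tilting by the largest zero `c` of `ψ` produces an exponent that is positive on `(0,∞)`, as
  -- `exists_potential` demands.
  have hc0 : 0 ≤ c := rightInverse_nonneg 0
  have hψc : ψ c = 0 := rightInverse_mem hc htop h0 le_rfl
  have hfin : ∀ θ, 0 ≤ θ → expMoment (Λ.restrict (Iic (-1))) θ ≠ ∞ := fun θ hθ =>
    expMoment_restrict_ne_top hθ hΛ.expMoment_restrict_zero_ne_top
  have hΛc := hΛ.tilt (hfin c hc0)
  have htilt : ∀ θ, 0 < θ → ψ (c + θ) = lkExp _ s _ θ := fun θ hθ => by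
    rw [← hΛ.lkExp_tilt b s (hfin c hc0) (hfin (c + θ) (by linarith)), ← hψ _ (by linarith),
      ← hψ c hc0, hψc, sub_zero]
  have hpos : ∀ θ, 0 < θ → 0 < ψ (c + θ) := fun θ hθ =>
    lt_of_rightInverse_lt hc htop (by linarith)
  obtain ⟨U, hUs, hU0, hUE⟩ := hΛc.exists_potential hs fun θ hθ => by
    rw [← htilt θ hθ]; exact hpos θ hθ
  obtain ⟨W, hW, hWm⟩ := isScaleFunction_of_potential (ψ := ψ) hU0 hpos fun θ hθ => by
    rw [hUE θ hθ, ← hcdef, htilt θ hθ]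
  exact scaleFunctionsExtend_of_monotone hc htop h0 hW hWm

/-! ### Tilting scale functions -/

/-- The function `e^{-cx} W^{(q)}(x)` has transform `1/(ψ(c+β) - q) = 1/(ψ'(β) - (q - ψ(c)))` for
large `β`, and Laplace transforms are unique. -/
theorem scaleFunction_tilt {ψ ψ' : ℝ → ℝ} (h : ScaleFunctionsExtend ψ)
    (h' : ScaleFunctionsExtend ψ') {c : ℝ} (hrel : ∀ θ, 0 ≤ θ → ψ' θ = ψ (c + θ) - ψ c) {q : ℝ}
    (hq : 0 ≤ q) (hqc : 0 ≤ q - ψ c) (x : ℝ) :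
    scaleFunction ψ q x = Real.exp (c * x) * scaleFunction ψ' (q - ψ c) x := by
  obtain ⟨W, hW, -⟩ := h.existsUnique q hq
  obtain ⟨V, hV, -⟩ := h'.existsUnique _ hqc
  rw [hW.scaleFunction_eq, hV.scaleFunction_eq]
  set β₀ := max (rightInverse ψ' (q - ψ c)) (rightInverse ψ q - c) + 1 with hβ₀
  have hβV : ∀ β, β₀ ≤ β → rightInverse ψ' (q - ψ c) < β := fun β hβ => by
    linarith [le_max_left (rightInverse ψ' (q - ψ c)) (rightInverse ψ q - c)]
  have hβW : ∀ β, β₀ ≤ β → rightInverse ψ q < c + β := fun β hβ => by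
    linarith [le_max_right (rightInverse ψ' (q - ψ c)) (rightInverse ψ q - c)]
  have htilt : ∀ β x, Real.exp (-β * x) * (Real.exp (-c * x) * W x) =
      Real.exp (-(c + β) * x) * W x := fun β x => by
    rw [← mul_assoc, ← Real.exp_add]
    ring_nf
  have hcausal : IsCausal fun x => Real.exp (-c * x) * W x :=
    ⟨fun x => mul_nonneg (Real.exp_nonneg _) (hW.nonneg x),
      fun x hx => by simp only [hW.eq_zero x hx, mul_zero],
      fun x hx => ContinuousWithinAt.mul (by fun_prop) (hW.right_continuous x hx)⟩
  have heq : (fun x => Real.exp (-c * x) * W x) = V := by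
    refine hcausal.eq_of_laplace_eq hV.isCausal (β₀ := β₀) (fun β hβ => ?_)
      (fun β hβ => hV.integrable β (hβV β hβ)) fun β hβ => ?_
    · simp_rw [htilt]
      exact hW.integrable _ (hβW β hβ)
    · simp_rw [htilt]
      rw [hW.laplace _ (hβW β hβ), hV.laplace β (hβV β hβ),
        hrel β ((rightInverse_nonneg _).trans (hβV β hβ).le)]
      ring_nf
  rw [← heq, ← mul_assoc, ← Real.exp_add]
  simp

theorem complexScaleFunction_tilt {ψ ψ' : ℝ → ℝ} (h : ScaleFunctionsExtend ψ)
    (h' : ScaleFunctionsExtend ψ') {c : ℝ} (hrel : ∀ θ, 0 ≤ θ → ψ' θ = ψ (c + θ) - ψ c) (q : ℂ)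
    (x : ℝ) : complexScaleFunction ψ q x =
      Complex.exp ((c * x : ℝ) : ℂ) * complexScaleFunction ψ' (q - (ψ c : ℝ)) x := by
  set q₀ : ℝ := max 0 (ψ c) with hq₀
  have hf : Differentiable ℂ fun q : ℂ => complexScaleFunction ψ q x := h.entire x
  have hg : Differentiable ℂ fun q : ℂ =>
      Complex.exp ((c * x : ℝ) : ℂ) * complexScaleFunction ψ' (q - (ψ c : ℝ)) x :=
    ((h'.entire x).comp (differentiable_id.sub_const _)).const_mul _
  have hreal : ∀ r : ℝ, q₀ ≤ r → complexScaleFunction ψ r x =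
      Complex.exp ((c * x : ℝ) : ℂ) * complexScaleFunction ψ' (r - (ψ c : ℝ)) x := fun r hr => by
    have h1 : 0 ≤ r := (le_max_left _ _).trans hr
    have h2 : 0 ≤ r - ψ c := sub_nonneg.2 ((le_max_right _ _).trans hr)
    rw [← h.eq_series r h1, ← Complex.ofReal_sub, ← h'.eq_series _ h2,
      scaleFunction_tilt h h' hrel h1 h2]
    push_cast
    rfl
  -- Real points decreasing strictly to `q₀` supply the accumulation point for the identity theorem.
  have hseq : Tendsto (fun n : ℕ => ((q₀ + 1 / ((n : ℝ) + 1) : ℝ) : ℂ)) atTop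
      (𝓝[≠] (q₀ : ℂ)) := by
    refine tendsto_nhdsWithin_iff.2 ⟨?_, Eventually.of_forall fun n => ?_⟩
    · have := tendsto_one_div_add_atTop_nhds_zero_nat (𝕜 := ℝ).const_add q₀
      rw [add_zero] at this
      exact (Complex.continuous_ofReal.tendsto _).comp this
    · have : (0 : ℝ) < 1 / ((n : ℝ) + 1) := by positivity
      rw [mem_compl_iff, mem_singleton_iff, Complex.ofReal_inj]
      linarith
  have hfreq := hseq.frequently (p := fun q : ℂ => complexScaleFunction ψ q x =
      Complex.exp ((c * x : ℝ) : ℂ) * complexScaleFunction ψ' (q - (ψ c : ℝ)) x)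
    (Frequently.of_forall fun n => hreal _ (by
      have : (0 : ℝ) < 1 / ((n : ℝ) + 1) := by positivity
      linarith))
  exact congrFun (AnalyticOnNhd.eq_of_frequently_eq (fun z _ => hf.analyticAt z)
    (fun z _ => hg.analyticAt z) hfreq) q

/-! ### Spectrally negative Lévy processes -/

theorem lkExp_smul (b s : ℝ) (Λ : Measure ℝ) (t : ℝ≥0) (θ : ℝ) :
    lkExp (t * b) (t * s) (t • Λ) θ = t * lkExp b s Λ θ := by
  rw [lkExp, lkExp, integral_smul_nnreal_measure, NNReal.smul_def, smul_eq_mul]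
  ring

theorem measure_Ioi_eq_zero_of_forall_Ici {ρ : Measure ℝ} (h : ∀ ε, 0 < ε → ρ (Ici ε) = 0) :
    ρ (Ioi 0) = 0 := by
  refine measure_mono_null (t := ⋃ n : ℕ, Ici (1 / ((n : ℝ) + 1))) (fun x hx => ?_)
    (measure_iUnion_null fun n => h _ (by positivity))
  obtain ⟨n, hn⟩ := exists_nat_one_div_lt (mem_Ioi.1 hx)
  exact mem_iUnion.2 ⟨n, hn.le⟩

/-- Chernoff: `ρ [ε,∞) ≤ e^{-nε}` for every `n`. -/
theorem measure_Ioi_eq_zero_of_expMoment_le_one {ρ : Measure ℝ}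
    (h : ∀ β, 0 ≤ β → expMoment ρ β ≤ 1) : ρ (Ioi 0) = 0 := by
  refine measure_Ioi_eq_zero_of_forall_Ici fun ε hε => ?_
  have hle : ∀ n : ℕ, ρ (Ici ε) ≤ (ENNReal.ofReal (Real.exp (n * ε)))⁻¹ := fun n => by
    have h1 : ρ (Ici ε) ≤ ρ {x | ENNReal.ofReal (Real.exp (n * ε)) ≤
        ENNReal.ofReal (Real.exp (n * x))} := measure_mono fun x hx =>
      ENNReal.ofReal_le_ofReal (Real.exp_le_exp.2
        (mul_le_mul_of_nonneg_left hx (Nat.cast_nonneg n)))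
    refine h1.trans ((meas_ge_le_lintegral_div (by fun_prop)
      (ENNReal.ofReal_pos.2 (Real.exp_pos _)).ne' ENNReal.ofReal_ne_top).trans ?_)
    rw [← one_div]
    gcongr
    exact h n (Nat.cast_nonneg n)
  have hlim : Tendsto (fun n : ℕ => (ENNReal.ofReal (Real.exp (n * ε)))⁻¹) atTop (𝓝 0) := by
    rw [← ENNReal.inv_top]
    exact tendsto_inv_iff.2 (ENNReal.tendsto_ofReal_atTop.comp
      (Real.tendsto_exp_atTop.comp (tendsto_natCast_atTop_atTop.atTop_mul_const hε)))
  exact le_antisymm (ge_of_tendsto' hlim hle) bot_le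

theorem frequently_mem_dense_nhdsGT {D : Set ℝ≥0} (hD : Dense D) (t : ℝ≥0) :
    ∃ᶠ v in 𝓝[>] t, v ∈ D := by
  intro hev
  obtain ⟨u, hu, hsub⟩ := mem_nhdsGT_iff_exists_Ioo_subset.1 hev
  obtain ⟨v, hvD, hv⟩ := hD.exists_between (mem_Ioi.1 hu)
  exact hsub hv hvD

theorem antitone_of_dense {f : ℝ≥0 → ℝ} (hf : ∀ t, ContinuousWithinAt f (Ici t) t) {D : Set ℝ≥0}
    (hD : Dense D) (h : ∀ u ∈ D, ∀ v ∈ D, u ≤ v → f v ≤ f u) : Antitone f := by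
  have hlim : ∀ t, Tendsto f (𝓝[>] t) (𝓝 (f t)) := fun t =>
    (hf t).mono_left (nhdsWithin_mono _ Ioi_subset_Ici_self)
  intro s t hst
  rcases hst.eq_or_lt with rfl | hst
  · exact le_rfl
  refine isClosed_Ici.mem_of_frequently_of_tendsto (s := Ici (f t)) ?_ (hlim s)
  refine ((frequently_mem_dense_nhdsGT hD s).and_eventually (Ioo_mem_nhdsGT hst)).mono ?_
  rintro u ⟨huD, hu⟩
  refine isClosed_Iic.mem_of_frequently_of_tendsto (s := Iic (f u)) ?_ (hlim t)
  refine ((frequently_mem_dense_nhdsGT hD t).and_eventually self_mem_nhdsWithin).mono ?_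
  rintro v ⟨hvD, hv⟩
  exact h u huD v hvD (hu.2.trans hv).le

section LevyPaths

variable {Ω : Type*} {m : MeasurableSpace Ω} {P : Measure Ω} {𝓕 : Filtration ℝ≥0 m}
  {X : ℝ≥0 → Ω → ℝ}

theorem IsLevyProcess.measurable (hX : IsLevyProcess P 𝓕 X) (t : ℝ≥0) : Measurable (X t) :=
  (hX.adapted t).mono (𝓕.le t) le_rfl

theorem expMoment_map {Y : Ω → ℝ} (hY : Measurable Y) (c : ℝ) :
    expMoment (P.map Y) c = ∫⁻ ω, ENNReal.ofReal (Real.exp (c * Y ω)) ∂P :=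
  lintegral_map (by fun_prop) hY

theorem expMoment_map_ne_top_iff {Y : Ω → ℝ} (hY : Measurable Y) (c : ℝ) :
    expMoment (P.map Y) c ≠ ∞ ↔ Integrable (fun ω => Real.exp (c * Y ω)) P := by
  rw [expMoment_map hY]
  constructor
  · intro h
    refine ⟨(by fun_prop : Measurable fun ω => Real.exp (c * Y ω)).aestronglyMeasurable, ?_⟩
    rw [hasFiniteIntegral_iff_ofReal (ae_of_all _ fun ω => Real.exp_nonneg _)]
    exact h.lt_top
  · intro h
    rw [← ofReal_integral_eq_lintegral_ofReal h (ae_of_all _ fun ω => Real.exp_nonneg _)]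
    exact ENNReal.ofReal_ne_top

theorem laplaceExponent_eq (hX : Measurable (X 1)) {c r : ℝ}
    (h : expMoment (P.map (X 1)) c = ENNReal.ofReal (Real.exp r)) : laplaceExponent P X c = r := by
  rw [expMoment_map hX] at h
  rw [laplaceExponent, cgf, mgf, integral_eq_lintegral_of_nonneg_ae
    (ae_of_all _ fun ω => Real.exp_nonneg _) (by fun_prop), h,
    ENNReal.toReal_ofReal (Real.exp_nonneg _), Real.log_exp]

/-- The exponential moments of a Lévy process without positive jumps. -/
theorem IsSpectrallyNegative.exists_lkExp [IsProbabilityMeasure P]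
    (hX : IsSpectrallyNegative P 𝓕 X) :
    ∃ (b s : ℝ) (Λ : Measure ℝ), 0 ≤ s ∧ IsNegLevyMeasure Λ ∧
      (∀ t β, 0 ≤ β → expMoment (P.map (X t)) β = ENNReal.ofReal (Real.exp (t * lkExp b s Λ β))) ∧
      ∀ c, expMoment (P.map (X 1)) c ≠ ∞ → expMoment (Λ.restrict (Iic (-1))) c ≠ ∞ ∧
        ∀ θ, c ≤ θ → expMoment (P.map (X 1)) θ = ENNReal.ofReal (Real.exp (lkExp b s Λ θ)) := by
  obtain ⟨μ, σ, Λ, hΛ, hpos, hcf⟩ := hX.no_positive_jumps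
  have hΛ' : IsNegLevyMeasure Λ := by
    refine ⟨?_, hΛ.2⟩
    rw [← Ioi_union_left]
    exact measure_union_null hpos hΛ.1
  have hs : (0 : ℝ) ≤ σ ^ 2 / 2 := by positivity
  have hprob : ∀ t, IsProbabilityMeasure (P.map (X t)) := fun t =>
    Measure.isProbabilityMeasure_map (hX.measurable t).aemeasurable
  -- The law of `X t` has triple `t` times that of `X 1`; the sign convention of
  -- `levyKhintchineExponent` turns `μ` into drift `-μ`.
  have hcf' : ∀ (t : ℝ≥0) (θ : ℝ), charFun (P.map (X t)) θ =
      Complex.exp (Complex.I * ((t * -μ : ℝ) : ℂ) * θ - ((t * (σ ^ 2 / 2) : ℝ) : ℂ) * θ ^ 2 +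
        ∫ x : ℝ, (Complex.exp (Complex.I * θ * x) - 1 -
          (if |x| < 1 then Complex.I * θ * x else 0)) ∂(t • Λ)) := fun t θ => by
    have hneg : ∫ x : ℝ, (1 - Complex.exp (Complex.I * θ * x) +
        (if |x| < 1 then Complex.I * θ * x else 0)) ∂Λ =
        -∫ x : ℝ, (Complex.exp (Complex.I * θ * x) - 1 -
          (if |x| < 1 then Complex.I * θ * x else 0)) ∂Λ := by
      rw [← integral_neg]
      congr with x
      ring
    rw [hcf, levyKhintchineExponent, hneg, integral_smul_nnreal_measure, NNReal.smul_def,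
      Complex.real_smul]
    congr 1
    push_cast
    ring
  have hE := fun t c => (hΛ'.smul t).expMoment_of_charFun (mul_nonneg (NNReal.coe_nonneg t) hs) (hcf' t) c
  refine ⟨-μ, σ ^ 2 / 2, Λ, hs, hΛ', fun t β hβ => ?_, fun c hc => ?_⟩
  · rw [← lkExp_smul]
    refine (hE t β).2 ((hE t β).1.2 ?_)
    exact IsNegLevyMeasure.expMoment_restrict_ne_top hβ (hΛ'.smul t).expMoment_restrict_zero_ne_top
  · have h1 := fun c => hE 1 c
    simp only [NNReal.coe_one, one_mul, one_smul] at h1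
    have hc' := (h1 c).1.1 hc
    exact ⟨hc', fun θ hθ => (h1 θ).2 ((h1 θ).1.2
      (IsNegLevyMeasure.expMoment_restrict_ne_top hθ hc'))⟩

/-- If `X 1 ≤ 0` a.s., then `ψ ≤ 0` on `[0,∞)`, so `E e^{βX_t} ≤ 1` for all `β ≥ 0` and hence `X t ≤
0` a.s. for every `t`. By stationarity all increments are nonpositive; a countable dense set of
times and right-continuity make the paths decreasing, which is excluded. -/
theorem IsSpectrallyNegative.measure_pos_ne_zero [IsProbabilityMeasure P]
    (hX : IsSpectrallyNegative P 𝓕 X) : P.map (X 1) (Ioi 0) ≠ 0 := by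
  intro h0
  obtain ⟨b, s, Λ, -, -, hE, -⟩ := hX.exists_lkExp
  have hlk : ∀ β, 0 ≤ β → lkExp b s Λ β ≤ 0 := fun β hβ => by
    have hle : expMoment (P.map (X 1)) β ≤ 1 := by
      have hprob : IsProbabilityMeasure (P.map (X 1)) :=
        Measure.isProbabilityMeasure_map (hX.measurable 1).aemeasurable
      have hae : ∀ᵐ x ∂(P.map (X 1)), x ≤ 0 := by
        rw [ae_iff]
        simp only [not_le]
        exact h0
      calc expMoment (P.map (X 1)) β ≤ ∫⁻ _, 1 ∂(P.map (X 1)) := by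
            refine lintegral_mono_ae ?_
            filter_upwards [hae] with x hx
            exact ENNReal.ofReal_le_one.2 (Real.exp_le_one_iff.2
              (mul_nonpos_of_nonneg_of_nonpos hβ hx))
        _ = 1 := by simp
    rw [hE 1 β hβ, NNReal.coe_one, one_mul, ENNReal.ofReal_le_one, Real.exp_le_one_iff] at hle
    exact hle
  have hXt : ∀ t, P.map (X t) (Ioi 0) = 0 := fun t => by
    refine measure_Ioi_eq_zero_of_expMoment_le_one fun β hβ => ?_
    rw [hE t β hβ, ENNReal.ofReal_le_one, Real.exp_le_one_iff]
    exact mul_nonpos_of_nonneg_of_nonpos t.2 (hlk β hβ)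
  have hinc : ∀ u v : ℝ≥0, u ≤ v → ∀ᵐ ω ∂P, X v ω ≤ X u ω := fun u v huv => by
    have h1 := (hX.stationary_increments u v huv).measure_mem_eq (measurableSet_Ioi (a := (0 : ℝ)))
    rw [← Measure.map_apply (hX.measurable (v - u)) measurableSet_Ioi, hXt] at h1
    rw [ae_iff]
    refine measure_mono_null (fun ω hω => ?_) h1
    exact sub_pos.2 (not_le.1 hω)
  refine hX.not_decreasing ?_
  obtain ⟨D, hDc, hD⟩ := TopologicalSpace.exists_countable_dense ℝ≥0
  have hall : ∀ᵐ ω ∂P, ∀ u ∈ D, ∀ v ∈ D, u ≤ v → X v ω ≤ X u ω := by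
    refine (ae_ball_iff hDc).2 fun u _ => (ae_ball_iff hDc).2 fun v _ => ?_
    by_cases huv : u ≤ v
    · filter_upwards [hinc u v huv] with ω hω _ using hω
    · exact ae_of_all _ fun ω h => absurd h huv
  filter_upwards [hall] with ω hω
  exact antitone_of_dense (hX.right_continuous ω) hD hω

/-- Chernoff's inequality read backwards: `ψ(β) ≥ βε + log P(X_1 ≥ ε)`, with `ε > 0` chosen so that
the probability is positive. -/
theorem IsSpectrallyNegative.tendsto_laplaceExponent [IsProbabilityMeasure P]
    (hX : IsSpectrallyNegative P 𝓕 X) : Tendsto (laplaceExponent P X) atTop atTop := by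
  obtain ⟨b, s, Λ, -, -, hE, -⟩ := hX.exists_lkExp
  obtain ⟨ε, hε, hεp⟩ : ∃ ε, 0 < ε ∧ P.map (X 1) (Ici ε) ≠ 0 := by
    by_contra! h
    exact hX.measure_pos_ne_zero (measure_Ioi_eq_zero_of_forall_Ici h)
  have hm := hX.measurable 1
  rw [Measure.map_apply hm measurableSet_Ici] at hεp
  have hp : 0 < P.real {ω | ε ≤ X 1 ω} := ENNReal.toReal_pos hεp (measure_ne_top _ _)
  have hlin : Tendsto (fun β => β * ε + Real.log (P.real {ω | ε ≤ X 1 ω})) atTop atTop :=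
    tendsto_atTop_add_const_right _ _ (tendsto_id.atTop_mul_const hε)
  refine tendsto_atTop_mono' _ ?_ hlin
  filter_upwards [eventually_ge_atTop 0] with β hβ
  have hint : Integrable (fun ω => Real.exp (β * X 1 ω)) P := by
    rw [← expMoment_map_ne_top_iff hm, hE 1 β hβ]
    exact ENNReal.ofReal_ne_top
  have h1 := measure_ge_le_exp_cgf ε hβ hint
  have h2 := Real.log_le_log hp h1
  rw [Real.log_exp] at h2
  rw [laplaceExponent]
  linarith

theorem IsExpChangeOfMeasure.map_eq (hX : IsLevyProcess P 𝓕 X) {c : ℝ} {Q : Measure Ω}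
    (hQ : IsExpChangeOfMeasure P 𝓕 X c 1 Q) :
    Q.map (X 1) = ENNReal.ofReal (Real.exp (-laplaceExponent P X c)) •
      (P.map (X 1)).withDensity fun x => ENNReal.ofReal (Real.exp (c * x)) := by
  have hm := hX.measurable 1
  ext B hB
  rw [Measure.map_apply hm hB, hQ _ (hX.adapted 1 hB), Measure.smul_apply, withDensity_apply _ hB,
    setLIntegral_map hB (by fun_prop) hm, smul_eq_mul, ← lintegral_const_mul _ (by fun_prop)]
  congr with ω
  rw [← ENNReal.ofReal_mul (Real.exp_nonneg _), ← Real.exp_add, NNReal.coe_one]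
  ring_nf

end LevyPaths

/-! ### Scale functions under the exponential change of measure -/

theorem mainTheorem8 {Ω : Type*} {m : MeasurableSpace Ω} (P : Measure Ω) [IsProbabilityMeasure P]
    (𝓕 : Filtration ℝ≥0 m) (X : ℝ≥0 → Ω → ℝ) (hX : IsSpectrallyNegative P 𝓕 X) :
    ScaleFunctionsExtend (laplaceExponent P X) ∧
    ∀ c : ℝ, Integrable (fun ω => Real.exp (c * X 1 ω)) P →
      ∀ Q : Measure Ω, IsExpChangeOfMeasure P 𝓕 X c 1 Q →
        ScaleFunctionsExtend (laplaceExponent Q X) ∧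
        ∀ (q : ℂ) (x : ℝ), 0 ≤ x →
          complexScaleFunction (laplaceExponent P X) q x =
            Complex.exp ((c * x : ℝ) : ℂ) *
              complexScaleFunction (laplaceExponent Q X) (q - (laplaceExponent P X c : ℝ)) x := by
  obtain ⟨b, s, Λ, hs, hΛ, hE, hEc⟩ := hX.exists_lkExp
  have hm := hX.measurable 1
  have htop := hX.tendsto_laplaceExponent
  have hψ : ∀ θ, 0 ≤ θ → laplaceExponent P X θ = lkExp b s Λ θ := fun θ hθ =>
    laplaceExponent_eq hm (by rw [hE 1 θ hθ, NNReal.coe_one, one_mul])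
  have hP := hΛ.scaleFunctionsExtend hs hψ htop
  refine ⟨hP, fun c hc Q hQ => ?_⟩
  obtain ⟨hc', hcθ⟩ := hEc c ((expMoment_map_ne_top_iff hm c).2 hc)
  have hψc : ∀ θ, c ≤ θ → laplaceExponent P X θ = lkExp b s Λ θ := fun θ hθ =>
    laplaceExponent_eq hm (hcθ θ hθ)
  -- Only the law of `X 1` under `Q` enters the Laplace exponent, so the density at time `1`
  -- suffices, and the Lévy property under `Q` is never needed.
  have hrel : ∀ θ, 0 ≤ θ →
      laplaceExponent Q X θ = laplaceExponent P X (c + θ) - laplaceExponent P X c := fun θ hθ => by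
    refine laplaceExponent_eq hm ?_
    rw [hQ.map_eq hX.toIsLevyProcess, expMoment_smul, expMoment_withDensity_exp,
      hcθ _ (by linarith), hψc (c + θ) (by linarith), ← ENNReal.ofReal_mul (Real.exp_nonneg _),
      ← Real.exp_add]
    ring_nf
  have hQtop : Tendsto (laplaceExponent Q X) atTop atTop := by
    have h1 : Tendsto (fun θ => laplaceExponent P X (c + θ) - laplaceExponent P X c) atTop atTop :=
      tendsto_atTop_add_const_right _ _ (htop.comp (tendsto_atTop_add_const_left _ _ tendsto_id))
    refine h1.congr' ?_
    filter_upwards [eventually_ge_atTop 0] with θ hθ using (hrel θ hθ).symm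
  -- For negative `c` the tilt is legitimate because finiteness of `E e^{cX_1}` makes `e^{cx}`
  -- integrable over the large jumps.
  have hQψ : ∀ θ, 0 ≤ θ → laplaceExponent Q X θ = lkExp _ s _ θ := fun θ hθ => by
    rw [hrel θ hθ, hψc _ (by linarith), hψc c le_rfl]
    exact hΛ.lkExp_tilt b s hc' (IsNegLevyMeasure.expMoment_restrict_ne_top (by linarith) hc')
  have hQext := (hΛ.tilt hc').scaleFunctionsExtend hs hQψ hQtop
  exact ⟨hQext, fun q x _ => complexScaleFunction_tilt hP hQext hrel q x⟩
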